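/- For a finite non-empty graph $G$, order the vertices of $G$ uniformly at random and build an independent set $\mathbf I(G)$ by considering the vertices one by one in this order, adding a vertex whenever the resulting set spans no edge. Let $\iota(G)=|\mathbf I(G)|/|V(G)|$ be the (random) greedy independence ratio. For a rooted graph $(U,\rho)$, let $\sigma=(\sigma_v)_{v\in V(U)}$ be independent labels, uniform in $[0,1]$, and let the past of $\rho$ be the set of vertices (including $\rho$) that can be reached from $\rho$ by a path along which the labels strictly decrease. If the past of $\rho$ is almost surely finite, we say that $(U,\rho)$ has nonexplosive growth, and we let $\iota(U,\rho)$ be the probability that $\rho$ belongs to the greedy independent set of the subgraph of $U$ induced by the past of $\rho$, its vertices being considered in increasing order of their labels. Let $d\ge 3$ be an integer and let $$c_d=\tfrac12\left(1-(d-1)^{-2/(d-2)}\right).$$ 1. The $d$-regular tree $\mathbb T_d$, with any vertex $\rho$ as its root, has nonexplosive growth, and $\iota(\mathbb T_d,\rho)=c_d$. 2. If $(G_n)$ is a sequence of finite $d$-regular graphs whose girth tends to infinity, then $\iota(G_n)\to c_d$ with high probability; that is, for every $\varepsilon>0$, $\mathbb P\left[|\iota(G_n)-c_d|<\varepsilon\right]\to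 1$ as $n\to\infty$. 3. Let $G(n,d)$ be a uniformly random $d$-regular simple graph on $n$ labelled vertices ($dn$ even). Then $\iota(G(n,d))\to c_d$ with high probability; that is, for every $\varepsilon>0$, $\mathbb P\left[|\iota(G(n,d))-c_d|<\varepsilon\right]\to 1$ as $n\to\infty$ along the integers $n$ with $dn$ even, where the probability is over both the random graph and the random ordering of its vertices. -/

import Mathlib

open Filter Topology MeasureTheory

noncomputable section

/-- One step of the greedy algorithm: the vertex `v` is added to the set `I` built so far exactly
when the resulting set spans no edge of `G`. -/
def greedyStep {V : Type*} (G : SimpleGraph V) (I : Set V) (v : V) : Set V :=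
  open Classical in if G.IsIndepSet (insert v I) then insert v I else I

/-- The set built by the greedy algorithm on `G` when the vertices are considered one by one in
the order of the list `l`. -/
def greedyMIS {V : Type*} (G : SimpleGraph V) (l : List V) : Set V :=
  l.foldl (greedyStep G) ∅

/-- The orderings of the vertices of a finite graph: `π i` is the `i`-th vertex. -/
abbrev VertexOrder (V : Type*) [Fintype V] : Type _ := Fin (Fintype.card V) ≃ V

/-- The greedy independence ratio `|I(G)| / |V(G)|` for the ordering `π` of the vertices. -/
def greedyRatio {V : Type*} [Fintype V] (G : SimpleGraph V) (π : VertexOrder V) : ℝ :=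
  ((greedyMIS G (List.ofFn π)).ncard : ℝ) / (Fintype.card V : ℝ)

/-- The probability of the event `p` for a uniformly random element of the finite type `Ω`. -/
def uniformProb (Ω : Type*) [Finite Ω] (p : Ω → Prop) : ℝ :=
  (Nat.card {ω : Ω // p ω} : ℝ) / (Nat.card Ω : ℝ)

/-- The `d`-regular (simple) graphs on the vertex set `Fin n`. -/
abbrev RegularGraphOn (n d : ℕ) : Type :=
  open Classical in {G : SimpleGraph (Fin n) // G.IsRegularOfDegree d}

/-- The past of `v` with respect to the labelling `σ`: all vertices that are reachable from `v` by
a path along which the labels strictly decrease (`v` itself included). -/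
def past {V : Type*} (G : SimpleGraph V) (σ : V → unitInterval) (v : V) : Set V :=
  {u | Relation.ReflTransGen (fun a b => G.Adj a b ∧ σ b < σ a) v u}

/-- The law of a random labelling: independent labels, uniform in `[0,1]`. -/
def labelMeasure (V : Type*) : Measure (V → unitInterval) :=
  Measure.infinitePi (fun _ : V => (volume : Measure unitInterval))

/-- The rooted graph `(U, ρ)` has nonexplosive growth: the past of the root is almost surely
finite. -/
def NonexplosiveGrowth {V : Type*} (U : SimpleGraph V) (ρ : V) : Prop :=
  ∀ᵐ σ ∂(labelMeasure V), (past U σ ρ).Finite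

/-- The vertices of a finite graph listed in increasing order of their labels. (Ties, which have
probability zero for a random labelling, are broken in an arbitrary way.) -/
def labelOrder {W : Type*} [Fintype W] (σ : W → unitInterval) : List W :=
  (Finset.univ : Finset W).toList.mergeSort (fun u v => decide (σ u ≤ σ v))

/-- The event that the past of `ρ` is finite and `ρ` belongs to the greedy independent set of the
subgraph of `U` induced by the past of `ρ`, where vertices are considered in increasing order of
their labels. -/
def rootOccupied {V : Type*} (U : SimpleGraph V) (ρ : V) : Set (V → unitInterval) :=
  {σ | ∃ h : (past U σ ρ).Finite,
    (⟨ρ, Relation.ReflTransGen.refl⟩ : past U σ ρ) ∈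
      greedyMIS (U.induce (past U σ ρ))
        (@labelOrder (past U σ ρ) h.fintype (fun v => σ v))}

/-- The probability `ι(U, ρ)` that the root belongs to the greedy independent set of its past;
meaningful when `(U, ρ)` has nonexplosive growth. -/
def greedyDensity {V : Type*} (U : SimpleGraph V) (ρ : V) : ℝ :=
  (labelMeasure V).real (rootOccupied U ρ)

end

/-!
A vertex joins the greedy set exactly when none of its neighbours with a smaller label does.
Truncating this recursion after an odd or an even number of rounds gives a lower or an upper bound
for the greedy set, and both truncations agree with it as soon as the past of the vertex has no long
decreasing path. A decreasing path of length `k` has probability `1 / (k + 1)!`, which beats the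
number `d ^ k` of paths of length `k`, so the truncations are exact up to an error tending to `0`,
uniformly over all graphs of degree at most `d`.

In a tree the branches below a vertex are independent, so the probability that no neighbour with
label below `x` blocks the vertex is a `d`-th or `(d - 1)`-th power of a survival function, and the
survival functions of the successive truncations are the Picard iterates of `y' = -y ^ (d - 1)`,
`y 0 = 1`. Their limit is `y t = (1 + (d - 2) t) ^ (-1 / (d - 2))`, and `∫ y ^ d` over `[0, 1]` is
`c_d`.

In a finite graph the truncation at a vertex only depends on a ball around it. Hence its mean is
that of the tree at all vertices whose ball is a tree, distant vertices are independent, and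
Chebyshev's inequality gives the concentration. Large girth makes every ball a tree; for the random
regular graph, switching two edges shows that `l` fixed edges are present with probability
`O(n ^ (-l))`, so the expected number of short cycles is bounded and Markov's inequality applies.
-/

/-! ### The greedy recursion -/

section GreedyRecursion

variable {V α : Type*} [LinearOrder α] {G : SimpleGraph V} {σ : V → α}

/-- The `k`-th approximation of the event that `v` belongs to the greedy independent set: a vertex
is occupied at round `k + 1` when no smaller neighbour is occupied at round `k`, all vertices being
occupied at round `0`. The neighbour `w` from which `v` has been reached is disregarded, so that
different branches of a tree do not interact; `w = v` disregards nothing. -/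
def IsOccupied (G : SimpleGraph V) (σ : V → α) : ℕ → V → V → Prop
  | 0, _, _ => True
  | k + 1, w, v => ∀ u, G.Adj v u → u ≠ w → σ u < σ v → ¬ IsOccupied G σ k v u

/-- The set `J` solves the greedy recursion on the set `P`, which is closed under passing to smaller
neighbours: a vertex of `P` is in `J` exactly when none of its smaller neighbours is. -/
structure IsGreedySolution (G : SimpleGraph V) (σ : V → α) (P J : Set V) : Prop where
  mem_of_adj_of_lt : ∀ v ∈ P, ∀ u, G.Adj v u → σ u < σ v → u ∈ P
  mem_iff : ∀ v ∈ P, v ∈ J ↔ ∀ u, G.Adj v u → σ u < σ v → u ∉ J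

lemma isOccupied_iff_self_of_lt {v w : V} (h : σ v < σ w) (k : ℕ) :
    IsOccupied G σ k w v ↔ IsOccupied G σ k v v := by
  cases k with
  | zero => exact Iff.rfl
  | succ k =>
    refine forall₂_congr fun u hvu => ⟨fun H _ hlt => H ?_ hlt, fun H _ hlt => H hvu.ne' hlt⟩
    rintro rfl
    exact lt_asymm hlt h

lemma isOccupied_succ_self {v : V} (k : ℕ) :
    IsOccupied G σ (k + 1) v v ↔ ∀ u, G.Adj v u → σ u < σ v → ¬ IsOccupied G σ k u u := by
  refine forall₂_congr fun u hvu => ⟨fun H hlt => ?_, fun H _ hlt => ?_⟩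
  · rw [← isOccupied_iff_self_of_lt hlt]
    exact H hvu.ne' hlt
  · rw [isOccupied_iff_self_of_lt hlt]
    exact H hlt

namespace IsGreedySolution

variable {P J : Set V} (h : IsGreedySolution G σ P J)
include h

lemma mem_of_isOccupied_succ {k : ℕ} (upper : ∀ v ∈ P, v ∈ J → IsOccupied G σ k v v) {v : V}
    (hv : v ∈ P) (hocc : IsOccupied G σ (k + 1) v v) : v ∈ J :=
  (h.mem_iff v hv).2 fun u hvu hlt huJ =>
    isOccupied_succ_self k |>.1 hocc u hvu hlt (upper u (h.mem_of_adj_of_lt v hv u hvu hlt) huJ)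

lemma isOccupied_succ_of_mem {k : ℕ} (lower : ∀ v ∈ P, IsOccupied G σ k v v → v ∈ J) {v : V}
    (hv : v ∈ P) (hvJ : v ∈ J) : IsOccupied G σ (k + 1) v v :=
  isOccupied_succ_self k |>.2 fun u hvu hlt hocc =>
    (h.mem_iff v hv).1 hvJ u hvu hlt (lower u (h.mem_of_adj_of_lt v hv u hvu hlt) hocc)

lemma isOccupied_even {v : V} (hv : v ∈ P) (hvJ : v ∈ J) (k : ℕ) :
    IsOccupied G σ (2 * k) v v := by
  induction k generalizing v with
  | zero => trivial
  | succ k ih =>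
    exact h.isOccupied_succ_of_mem
      (fun _ => h.mem_of_isOccupied_succ (fun _ hw hwJ => ih hw hwJ)) hv hvJ

lemma mem_of_isOccupied_odd {v : V} (hv : v ∈ P) {k : ℕ}
    (hocc : IsOccupied G σ (2 * k + 1) v v) : v ∈ J :=
  h.mem_of_isOccupied_succ (fun _ hw hwJ => h.isOccupied_even hw hwJ k) hv hocc

end IsGreedySolution

end GreedyRecursion

/-! ### The greedy algorithm -/

section GreedyAlgorithm

variable {V : Type*} {G : SimpleGraph V} {I : Set V} {u v : V} {l l₁ l₂ : List V}

lemma mem_greedyStep_of_ne (h : u ≠ v) : u ∈ greedyStep G I v ↔ u ∈ I := by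
  unfold greedyStep
  split_ifs <;> simp [h]

lemma mem_greedyStep_self (hI : G.IsIndepSet I) (hv : v ∉ I) :
    v ∈ greedyStep G I v ↔ ∀ u ∈ I, ¬ G.Adj v u := by
  have isIndepSet_insert_iff : G.IsIndepSet (insert v I) ↔ ∀ u ∈ I, ¬ G.Adj v u := by
    have : Std.Symm fun v w => ¬ G.Adj v w := ⟨fun _ _ h h' => h h'.symm⟩
    rw [SimpleGraph.isIndepSet_iff, Set.pairwise_insert_of_symm_of_notMem hv]
    exact and_iff_right hI
  unfold greedyStep
  split_ifs with h
  · simpa using isIndepSet_insert_iff.1 h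
  · simp [hv, ← isIndepSet_insert_iff, h]

lemma mem_foldl_greedyStep_of_notMem (h : u ∉ l) :
    u ∈ l.foldl (greedyStep G) I ↔ u ∈ I := by
  induction l generalizing I with
  | nil => rfl
  | cons a l ih =>
    rw [List.mem_cons, not_or] at h
    rw [List.foldl_cons, ih h.2, mem_greedyStep_of_ne h.1]

lemma isIndepSet_greedyMIS (l : List V) : G.IsIndepSet (greedyMIS G l) := by
  refine List.foldlRecOn l (greedyStep G) (by simp [SimpleGraph.isIndepSet_iff]) fun I hI v _ => ?_
  unfold greedyStep
  split_ifs with h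
  exacts [h, hI]

lemma greedyMIS_append (l₁ l₂ : List V) :
    greedyMIS G (l₁ ++ l₂) = l₂.foldl (greedyStep G) (greedyMIS G l₁) :=
  List.foldl_append

lemma mem_of_mem_greedyMIS (h : u ∈ greedyMIS G l) : u ∈ l := by
  by_contra hu
  exact (mem_foldl_greedyStep_of_notMem hu).1 h

lemma mem_greedyMIS_append_cons (h : (l₁ ++ v :: l₂).Nodup) :
    v ∈ greedyMIS G (l₁ ++ v :: l₂) ↔
      ∀ u ∈ l₁, G.Adj v u → u ∉ greedyMIS G (l₁ ++ v :: l₂) := by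
  obtain ⟨-, hvl₂, hdisj⟩ := List.nodup_append.1 h
  have hv₁ : v ∉ greedyMIS G l₁ := fun hv =>
    hdisj v (mem_of_mem_greedyMIS hv) v List.mem_cons_self rfl
  have mem_append_iff : ∀ u ∈ l₁, u ∈ greedyMIS G (l₁ ++ v :: l₂) ↔ u ∈ greedyMIS G l₁ := by
    intro u hu
    rw [greedyMIS_append, mem_foldl_greedyStep_of_notMem fun hu' => hdisj u hu u hu' rfl]
  have mem_iff : v ∈ greedyMIS G (l₁ ++ v :: l₂) ↔ ∀ u ∈ greedyMIS G l₁, ¬ G.Adj v u := by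
    rw [greedyMIS_append, List.foldl_cons,
      mem_foldl_greedyStep_of_notMem (List.nodup_cons.1 hvl₂).1,
      mem_greedyStep_self (isIndepSet_greedyMIS l₁) hv₁]
  rw [mem_iff]
  exact ⟨fun H u hu huv hmem => H u ((mem_append_iff u hu).1 hmem) huv, fun H u hu huv =>
    have hul := mem_of_mem_greedyMIS hu
    H u hul huv ((mem_append_iff u hul).2 hu)⟩

lemma isGreedySolution_greedyMIS {α : Type*} [LinearOrder α] {σ : V → α} (hnodup : l.Nodup)
    (hfull : ∀ v, v ∈ l) (hsorted : l.Pairwise (fun u v => σ u ≤ σ v))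
    (hties : ∀ u v, G.Adj u v → σ u ≠ σ v) :
    IsGreedySolution G σ Set.univ (greedyMIS G l) := by
  refine ⟨fun _ _ _ _ _ => Set.mem_univ _, fun v _ => ?_⟩
  obtain ⟨l₁, l₂, rfl⟩ := List.append_of_mem (hfull v)
  obtain ⟨-, hsorted₂, hsorted₁⟩ := List.pairwise_append.1 hsorted
  have mem_earlier_iff_lt : ∀ u, G.Adj v u → (u ∈ l₁ ↔ σ u < σ v) := by
    refine fun u hvu => ⟨fun hu => ?_, fun hlt => ?_⟩
    · exact (hsorted₁ u hu v List.mem_cons_self).lt_of_ne (hties u v hvu.symm)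
    · rcases List.mem_append.1 (hfull u) with hu | hu
      · exact hu
      · rcases List.mem_cons.1 hu with rfl | hu
        · exact absurd hvu (G.irrefl)
        · exact absurd hlt ((List.pairwise_cons.1 hsorted₂).1 u hu).not_gt
  rw [mem_greedyMIS_append_cons hnodup]
  exact ⟨fun H u hvu hlt => H u ((mem_earlier_iff_lt u hvu).2 hlt) hvu,
    fun H u hu hvu => H u hvu ((mem_earlier_iff_lt u hvu).1 hu)⟩

end GreedyAlgorithm

/-! ### Independence of functions of disjoint sets of coordinates -/

section Independence

open ProbabilityTheory

lemma comap_le_iSup_comap_eval_of_dependsOn {ι β : Type*} {Ω : ι → Type*}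
    [∀ i, MeasurableSpace (Ω i)] [∀ i, Nonempty (Ω i)] [MeasurableSpace β] {f : (∀ i, Ω i) → β}
    {S : Set ι} (hf : Measurable f) (hS : DependsOn f S) :
    MeasurableSpace.comap f inferInstance ≤
      ⨆ i ∈ S, MeasurableSpace.comap (fun ω : ∀ i, Ω i => ω i) inferInstance := by
  classical
  have f_eq : f = f ∘ fun ω i => if i ∈ S then ω i else Classical.arbitrary (Ω i) :=
    funext fun ω => hS fun i hi => by simp [hi]
  rw [f_eq, ← MeasurableSpace.comap_comp]
  refine (MeasurableSpace.comap_mono hf.comap_le).trans (Measurable.comap_le ?_)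
  refine @measurable_pi_iff _ _ _ (_) _ _ |>.2 fun i => ?_
  by_cases hi : i ∈ S
  · simp only [hi, if_true]
    exact measurable_iff_comap_le.2 (le_iSup₂ (f := fun i (_ : i ∈ S) =>
      MeasurableSpace.comap (fun ω : ∀ i, Ω i => ω i) inferInstance) i hi)
  · simp only [hi, if_false]
    exact @measurable_const _ _ _ (_) _

lemma indepFun_infinitePi_of_dependsOn {ι β γ : Type*} {Ω : ι → Type*}
    [∀ i, MeasurableSpace (Ω i)] {P : ∀ i, Measure (Ω i)} [∀ i, IsProbabilityMeasure (P i)]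
    [MeasurableSpace β] [MeasurableSpace γ] {f : (∀ i, Ω i) → β} {g : (∀ i, Ω i) → γ}
    (hf : Measurable f) (hg : Measurable g) {S T : Set ι} (hfS : DependsOn f S)
    (hgT : DependsOn g T) (hST : Disjoint S T) : IndepFun f g (Measure.infinitePi P) := by
  have (i : ι) : Nonempty (Ω i) := nonempty_of_isProbabilityMeasure (P i)
  have indep_coordinates : iIndepFun (fun i (ω : ∀ i, Ω i) => ω i) (Measure.infinitePi P) :=
    iIndepFun_infinitePi (X := fun _ x => x) fun _ => measurable_id
  have indep_blocks :=
    indep_iSup_of_disjoint (fun i => (measurable_pi_apply i).comap_le) indep_coordinates hST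
  exact (IndepFun_iff_Indep f g _).2 <|
    indep_of_indep_of_le_left (indep_of_indep_of_le_right indep_blocks
      (comap_le_iSup_comap_eval_of_dependsOn hg hgT)) (comap_le_iSup_comap_eval_of_dependsOn hf hfS)

lemma dependsOn_finset_inf {ι κ β : Type*} [SemilatticeInf β] [OrderTop β]
    {Ω : ι → Type*} {s : Finset κ}
    {Z : κ → (∀ i, Ω i) → β} {S : κ → Set ι} (hS : ∀ k ∈ s, DependsOn (Z k) (S k)) :
    DependsOn (fun ω => s.inf fun k => Z k ω) (⋃ k ∈ s, S k) := fun _ _ h =>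
  Finset.inf_congr rfl fun k hk => hS k hk fun i hi => h i (Set.mem_biUnion hk hi)

variable {β : Type*} [LinearOrder β] [TopologicalSpace β] [OrderClosedTopology β]
  [SecondCountableTopology β] [MeasurableSpace β] [BorelSpace β]

lemma measureReal_mem_and_le_of_indepFun {Ω : Type*} [MeasurableSpace Ω] {μ : Measure Ω}
    [IsProbabilityMeasure μ] {X Y : Ω → β} (hX : Measurable X) (hY : Measurable Y)
    (hXY : IndepFun X Y μ) {B : Set β} (hB : MeasurableSet B) :
    μ.real {ω | X ω ∈ B ∧ X ω ≤ Y ω} = ∫ t in B, μ.real {ω | t ≤ Y ω} ∂(μ.map X) := by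
  have joint_law : μ.map (fun ω => (X ω, Y ω)) = (μ.map X).prod (μ.map Y) :=
    (indepFun_iff_map_prod_eq_prod_map_map hX.aemeasurable hY.aemeasurable).1 hXY
  have := Measure.isProbabilityMeasure_map (μ := μ) hX.aemeasurable
  have := Measure.isProbabilityMeasure_map (μ := μ) hY.aemeasurable
  set A : Set (β × β) := {q | q.1 ∈ B ∧ q.1 ≤ q.2}
  have hA : MeasurableSet A :=
    (measurable_fst hB).inter (measurableSet_le measurable_fst measurable_snd)
  have section_eq (t : β) :
      ((μ.map Y) (Prod.mk t ⁻¹' A)).toReal = B.indicator (fun t => μ.real {ω | t ≤ Y ω}) t := by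
    by_cases ht : t ∈ B
    · have : Prod.mk t ⁻¹' A = Set.Ici t := by ext; simp [A, ht]
      rw [this, Measure.map_apply hY measurableSet_Ici, Set.indicator_of_mem ht]
      rfl
    · have : Prod.mk t ⁻¹' A = ∅ := by ext; simp [A, ht]
      simp [this, ht]
  calc μ.real {ω | X ω ∈ B ∧ X ω ≤ Y ω}
      = ((μ.map X).prod (μ.map Y)).real A := by
        rw [← joint_law, map_measureReal_apply (hX.prodMk hY) hA]
        rfl
    _ = ∫ t, ((μ.map Y) (Prod.mk t ⁻¹' A)).toReal ∂(μ.map X) := by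
        rw [Measure.real, Measure.prod_apply hA,
          ← integral_toReal (measurable_measure_prodMk_left hA).aemeasurable
            (Eventually.of_forall fun _ => measure_lt_top _ _)]
    _ = ∫ t in B, μ.real {ω | t ≤ Y ω} ∂(μ.map X) := by
        simp_rw [section_eq, integral_indicator hB]

lemma measurable_finset_inf [OrderTop β] {ι Ω : Type*} [MeasurableSpace Ω] {s : Finset ι}
    {Z : ι → Ω → β} (hZ : ∀ i ∈ s, Measurable (Z i)) :
    Measurable (fun ω => s.inf fun i => Z i ω) := by
  convert Finset.inf_induction (f := Z) (p := Measurable) measurable_const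
    (fun _ hf _ hg => hf.inf hg) hZ using 1
  ext ω
  rw [Finset.inf_apply]

lemma measureReal_le_finset_inf_of_dependsOn [OrderTop β] {ι κ : Type*} {Ω : ι → Type*}
    [∀ i, MeasurableSpace (Ω i)] {P : ∀ i, Measure (Ω i)} [∀ i, IsProbabilityMeasure (P i)]
    {s : Finset κ} {Z : κ → (∀ i, Ω i) → β} {S : κ → Set ι} (hZ : ∀ k ∈ s, Measurable (Z k))
    (hS : ∀ k ∈ s, DependsOn (Z k) (S k)) (hdisj : (s : Set κ).PairwiseDisjoint S) (t : β) :
    (Measure.infinitePi P).real {ω | t ≤ s.inf fun k => Z k ω} =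
      ∏ k ∈ s, (Measure.infinitePi P).real {ω | t ≤ Z k ω} := by
  classical
  induction s using Finset.induction_on with
  | empty => simp
  | insert a s ha ih =>
    rw [Finset.forall_mem_insert] at hZ hS
    have disjoint_rest : Disjoint (S a) (⋃ k ∈ s, S k) := by
      rw [Set.disjoint_iUnion₂_right]
      exact fun k hk => hdisj (by simp) (by simp [hk]) (ne_of_mem_of_not_mem hk ha).symm
    have indep := indepFun_infinitePi_of_dependsOn (P := P) hZ.1 (measurable_finset_inf hZ.2) hS.1
      (dependsOn_finset_inf hS.2) disjoint_rest
    have event_eq : {ω | t ≤ (insert a s).inf fun k => Z k ω} =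
        Z a ⁻¹' Set.Ici t ∩ (fun ω => s.inf fun k => Z k ω) ⁻¹' Set.Ici t := by
      ext ω
      simp
    rw [Finset.prod_insert ha, ← ih hZ.2 hS.2 (hdisj.subset (by simp)), event_eq, Measure.real,
      indep.measure_inter_preimage_eq_mul _ _ measurableSet_Ici measurableSet_Ici,
      ENNReal.toReal_mul]
    rfl

end Independence

/-! ### The limiting differential equation -/

section DifferentialEquation

/-- The Picard iterates of the initial value problem `y' = -y ^ m`, `y 0 = 1`. In an infinite tree
where every vertex has `m` children, `picard m k x` is the probability that it is not the case that
a given vertex has label less than `x` and is occupied at round `k`. -/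
noncomputable def picard (m : ℕ) : ℕ → ℝ → ℝ
  | 0, x => 1 - x
  | k + 1, x => 1 - ∫ t in (0 : ℝ)..x, picard m k t ^ m

variable (m k : ℕ) {x : ℝ}

lemma continuous_picard : Continuous (picard m k) := by
  induction k with
  | zero => exact continuous_const.sub continuous_id
  | succ k ih =>
    exact continuous_const.sub <| intervalIntegral.continuous_primitive
      (fun a b => (ih.pow m).intervalIntegrable a b) 0

lemma picard_mem_Icc (hx : x ∈ Set.Icc (0 : ℝ) 1) : picard m k x ∈ Set.Icc (0 : ℝ) 1 := by
  induction k generalizing x with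
  | zero => exact ⟨sub_nonneg.2 hx.2, sub_le_self 1 hx.1⟩
  | succ k ih =>
    have pow_mem : ∀ t ∈ Set.Icc 0 x, picard m k t ^ m ∈ Set.Icc (0 : ℝ) 1 := fun t ht =>
      have ht' := ih ⟨ht.1, ht.2.trans hx.2⟩
      ⟨pow_nonneg ht'.1 m, pow_le_one₀ ht'.1 ht'.2⟩
    have integral_nonneg : 0 ≤ ∫ t in (0 : ℝ)..x, picard m k t ^ m :=
      intervalIntegral.integral_nonneg hx.1 fun t ht => (pow_mem t ht).1
    have integral_le : ∫ t in (0 : ℝ)..x, picard m k t ^ m ≤ x :=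
      calc ∫ t in (0 : ℝ)..x, picard m k t ^ m ≤ ∫ _t in (0 : ℝ)..x, (1 : ℝ) :=
            intervalIntegral.integral_mono_on hx.1
              (((continuous_picard m k).pow m).intervalIntegrable 0 x)
              (continuous_const.intervalIntegrable 0 x) fun t ht => (pow_mem t ht).2
        _ = x := by simp
    exact ⟨sub_nonneg.2 (integral_le.trans hx.2), sub_le_self 1 integral_nonneg⟩

lemma abs_pow_sub_pow_le_mul_abs_sub {a b : ℝ} (ha : a ∈ Set.Icc (0 : ℝ) 1)
    (hb : b ∈ Set.Icc (0 : ℝ) 1) : |a ^ m - b ^ m| ≤ m * |a - b| := by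
  have max_le_one : max |a| |b| ≤ 1 :=
    max_le (by rw [abs_of_nonneg ha.1]; exact ha.2) (by rw [abs_of_nonneg hb.1]; exact hb.2)
  calc |a ^ m - b ^ m| ≤ |a - b| * m * max |a| |b| ^ (m - 1) := abs_pow_sub_pow_le a b m
    _ ≤ |a - b| * m * 1 := by
        gcongr
        exact pow_le_one₀ (le_max_of_le_left (abs_nonneg a)) max_le_one
    _ = m * |a - b| := by ring

section Solution

variable {y : ℝ → ℝ} (hcont : ContinuousOn y (Set.Icc 0 1))
  (hmem : ∀ x ∈ Set.Icc (0 : ℝ) 1, y x ∈ Set.Icc (0 : ℝ) 1)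
  (hsol : ∀ x ∈ Set.Icc (0 : ℝ) 1, y x = 1 - ∫ t in (0 : ℝ)..x, y t ^ m)
include hcont hmem hsol

lemma abs_picard_sub_le (hx : x ∈ Set.Icc (0 : ℝ) 1) :
    |picard m k x - y x| ≤ (m * x) ^ k / k.factorial := by
  induction k generalizing x with
  | zero =>
    have hp := picard_mem_Icc m 0 hx
    have hy := hmem x hx
    rw [pow_zero, Nat.factorial_zero, Nat.cast_one, div_one, abs_le]
    constructor <;> linarith [hp.1, hp.2, hy.1, hy.2]
  | succ k ih =>
    have hsub : Set.uIcc 0 x ⊆ Set.Icc (0 : ℝ) 1 := by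
      rw [Set.uIcc_of_le hx.1]
      exact Set.Icc_subset_Icc le_rfl hx.2
    have hpicard : IntervalIntegrable (fun t => picard m k t ^ m) volume 0 x :=
      ((continuous_picard m k).pow m).intervalIntegrable 0 x
    have hy : IntervalIntegrable (fun t => y t ^ m) volume 0 x :=
      ((hcont.mono hsub).pow m).intervalIntegrable
    calc |picard m (k + 1) x - y x|
        = |∫ t in (0 : ℝ)..x, (picard m k t ^ m - y t ^ m)| := by
          rw [intervalIntegral.integral_sub hpicard hy, hsol x hx, picard, sub_sub_sub_cancel_left,
            abs_sub_comm]
      _ ≤ ∫ t in (0 : ℝ)..x, |picard m k t ^ m - y t ^ m| :=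
          intervalIntegral.abs_integral_le_integral_abs hx.1
      _ ≤ ∫ t in (0 : ℝ)..x, m * ((m * t) ^ k / k.factorial) := by
          refine intervalIntegral.integral_mono_on hx.1 (hpicard.sub hy).abs
            (Continuous.intervalIntegrable (by fun_prop) 0 x) fun t ht => ?_
          have ht' : t ∈ Set.Icc (0 : ℝ) 1 := ⟨ht.1, ht.2.trans hx.2⟩
          exact (abs_pow_sub_pow_le_mul_abs_sub m (picard_mem_Icc m k ht') (hmem t ht')).trans
            (by gcongr; exact ih ht')
      _ = ∫ t in (0 : ℝ)..x, ((m : ℝ) ^ (k + 1) / k.factorial) * t ^ k := by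
          congr 1 with t
          ring
      _ = (m * x) ^ (k + 1) / (k + 1).factorial := by
          rw [intervalIntegral.integral_const_mul, integral_pow, Nat.factorial_succ,
            zero_pow k.succ_ne_zero, sub_zero, mul_pow]
          push_cast
          field_simp

lemma tendsto_integral_picard_pow (n : ℕ) :
    Tendsto (fun k => ∫ t in (0 : ℝ)..1, picard m k t ^ n) atTop
      (𝓝 (∫ t in (0 : ℝ)..1, y t ^ n)) := by
  have hy : IntervalIntegrable (fun t => y t ^ n) volume 0 1 :=
    ContinuousOn.intervalIntegrable (by rw [Set.uIcc_of_le zero_le_one]; exact hcont.pow n)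
  have bound_tendsto : Tendsto (fun k : ℕ => n * ((m : ℝ) ^ k / k.factorial)) atTop (𝓝 0) := by
    simpa using (FloorSemiring.tendsto_pow_div_factorial_atTop (m : ℝ)).const_mul (n : ℝ)
  rw [tendsto_iff_dist_tendsto_zero]
  refine squeeze_zero (fun _ => dist_nonneg) (fun k => ?_) bound_tendsto
  have hpicard : IntervalIntegrable (fun t => picard m k t ^ n) volume 0 1 :=
    ((continuous_picard m k).pow n).intervalIntegrable 0 1
  rw [Real.dist_eq, ← intervalIntegral.integral_sub hpicard hy]
  calc |∫ t in (0 : ℝ)..1, (picard m k t ^ n - y t ^ n)|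
      ≤ ∫ t in (0 : ℝ)..1, |picard m k t ^ n - y t ^ n| :=
        intervalIntegral.abs_integral_le_integral_abs zero_le_one
    _ ≤ ∫ _t in (0 : ℝ)..1, n * ((m : ℝ) ^ k / k.factorial) := by
        refine intervalIntegral.integral_mono_on zero_le_one (hpicard.sub hy).abs
          (continuous_const.intervalIntegrable 0 1) fun t ht => ?_
        refine (abs_pow_sub_pow_le_mul_abs_sub n (picard_mem_Icc m k ht) (hmem t ht)).trans ?_
        gcongr
        refine (abs_picard_sub_le m k hcont hmem hsol ht).trans ?_
        gcongr
        · exact mul_nonneg m.cast_nonneg ht.1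
        · exact mul_le_of_le_one_right m.cast_nonneg ht.2
    _ = n * ((m : ℝ) ^ k / k.factorial) := by simp

end Solution

/-- The solution of the initial value problem `y' = -y ^ m`, `y 0 = 1`. -/
noncomputable def picardLimit (m : ℕ) (x : ℝ) : ℝ :=
  (1 + ((m : ℝ) - 1) * x) ^ (-1 / ((m : ℝ) - 1))

lemma picardLimit_zero : picardLimit m 0 = 1 := by simp [picardLimit]

variable {m} (hm : 2 ≤ m)
include hm

lemma one_le_one_add_mul (hx : 0 ≤ x) : 1 ≤ 1 + ((m : ℝ) - 1) * x := by
  have : (1 : ℝ) ≤ m := by exact_mod_cast one_le_two.trans hm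
  exact le_add_of_nonneg_right (mul_nonneg (by linarith) hx)

lemma picardLimit_mem_Icc (hx : 0 ≤ x) : picardLimit m x ∈ Set.Icc (0 : ℝ) 1 := by
  have hbase := one_le_one_add_mul hm hx
  have hexp : -1 / ((m : ℝ) - 1) ≤ 0 :=
    div_nonpos_of_nonpos_of_nonneg (by norm_num) (sub_nonneg.2 (by exact_mod_cast by omega))
  exact ⟨Real.rpow_nonneg (by linarith) _, Real.rpow_le_one_of_one_le_of_nonpos hbase hexp⟩

lemma hasDerivAt_picardLimit (hx : 0 ≤ x) :
    HasDerivAt (picardLimit m) (-picardLimit m x ^ m) x := by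
  have hm' : (m : ℝ) - 1 ≠ 0 := (sub_pos.2 (by exact_mod_cast by omega)).ne'
  have hbase : 0 < 1 + ((m : ℝ) - 1) * x := one_pos.trans_le (one_le_one_add_mul hm hx)
  have hderiv_base : HasDerivAt (fun x : ℝ => 1 + ((m : ℝ) - 1) * x) ((m : ℝ) - 1) x := by
    simpa using ((hasDerivAt_id x).const_mul ((m : ℝ) - 1)).const_add 1
  refine (hderiv_base.rpow_const (p := -1 / ((m : ℝ) - 1)) (Or.inl hbase.ne')).congr_deriv ?_
  rw [picardLimit, ← Real.rpow_natCast, ← Real.rpow_mul hbase.le,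
    mul_div_cancel₀ _ hm', neg_one_mul]
  congr 2
  field_simp
  ring

lemma continuousOn_picardLimit : ContinuousOn (picardLimit m) (Set.Icc 0 1) := fun _ hx =>
  (hasDerivAt_picardLimit hm hx.1).continuousAt.continuousWithinAt

lemma intervalIntegrable_picardLimit_pow (n : ℕ) (hx : x ∈ Set.Icc (0 : ℝ) 1) :
    IntervalIntegrable (fun t => picardLimit m t ^ n) volume 0 x := by
  refine ContinuousOn.intervalIntegrable (((continuousOn_picardLimit hm).mono ?_).pow n)
  rw [Set.uIcc_of_le hx.1]
  exact Set.Icc_subset_Icc le_rfl hx.2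

lemma picardLimit_eq_one_sub_integral (hx : x ∈ Set.Icc (0 : ℝ) 1) :
    picardLimit m x = 1 - ∫ t in (0 : ℝ)..x, picardLimit m t ^ m := by
  rw [intervalIntegral.integral_eq_sub_of_hasDerivAt (f := fun t => -picardLimit m t)
    (fun t ht => ?_) (intervalIntegrable_picardLimit_pow hm m hx), picardLimit_zero]
  · ring
  · rw [Set.uIcc_of_le hx.1] at ht
    simpa using! (hasDerivAt_picardLimit hm ht.1).neg

lemma integral_picardLimit_pow_succ :
    ∫ t in (0 : ℝ)..1, picardLimit m t ^ (m + 1) =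
      1 / 2 * (1 - (m : ℝ) ^ (-2 / ((m : ℝ) - 1))) := by
  have hderiv : ∀ t ∈ Set.uIcc (0 : ℝ) 1,
      HasDerivAt (fun t => -(picardLimit m t ^ 2 / 2)) (picardLimit m t ^ (m + 1)) t := by
    intro t ht
    rw [Set.uIcc_of_le zero_le_one] at ht
    refine (((hasDerivAt_picardLimit hm ht.1).pow 2).div_const 2).neg.congr_deriv ?_
    push_cast
    ring
  have picardLimit_one_sq : picardLimit m 1 ^ 2 = (m : ℝ) ^ (-2 / ((m : ℝ) - 1)) := by
    rw [picardLimit, mul_one, add_sub_cancel, ← Real.rpow_natCast, ← Real.rpow_mul m.cast_nonneg]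
    push_cast
    ring_nf
  rw [intervalIntegral.integral_eq_sub_of_hasDerivAt hderiv
    (intervalIntegrable_picardLimit_pow hm _ (Set.right_mem_Icc.2 zero_le_one)),
    picardLimit_zero, picardLimit_one_sq]
  ring

end DifferentialEquation

section LimitingDensity

/-- The limiting density `c_d` of the greedy independent set on the `d`-regular tree. -/
noncomputable def greedyLimit (d : ℕ) : ℝ := 1 / 2 * (1 - ((d : ℝ) - 1) ^ (-2 / ((d : ℝ) - 2)))

/-- The probability that the root of the `d`-regular tree is occupied at round `k + 1` of the greedy
recursion: given that its label is `t`, each of its `d` neighbours independently leaves it free with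
probability `picard (d - 1) k t`. -/
noncomputable def treeOccupation (d k : ℕ) : ℝ := ∫ t in (0 : ℝ)..1, picard (d - 1) k t ^ d

lemma tendsto_treeOccupation {d : ℕ} (hd : 3 ≤ d) :
    Tendsto (treeOccupation d) atTop (𝓝 (greedyLimit d)) := by
  obtain ⟨m, rfl⟩ : ∃ m, d = m + 1 := ⟨d - 1, by omega⟩
  have hm : 2 ≤ m := by omega
  have limit_eq : greedyLimit (m + 1) = ∫ t in (0 : ℝ)..1, picardLimit m t ^ (m + 1) := by
    rw [integral_picardLimit_pow_succ hm, greedyLimit]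
    push_cast
    ring_nf
  rw [limit_eq]
  exact tendsto_integral_picard_pow m (continuousOn_picardLimit hm)
    (fun x hx => picardLimit_mem_Icc hm hx.1) (fun x hx => picardLimit_eq_one_sub_integral hm hx)
    (m + 1)

end LimitingDensity

/-! ### Occupation probabilities in locally tree-like graphs -/

section RandomLabels

variable {V : Type*}

instance : IsProbabilityMeasure (labelMeasure V) := by
  unfold labelMeasure
  infer_instance

lemma map_eval_labelMeasure (v : V) : (labelMeasure V).map (fun σ => σ v) = volume :=
  Measure.infinitePi_map_eval (fun _ : V => (volume : Measure unitInterval)) v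

lemma map_comp_labelMeasure {W : Type*} {f : W → V} (hf : Function.Injective f) :
    (labelMeasure V).map (fun σ => σ ∘ f) = labelMeasure W :=
  Measure.map_infinitePi_infinitePi_of_inj
    (P := fun _ : V => (volume : Measure unitInterval)) hf

lemma measureReal_le_label (v : V) (t : unitInterval) :
    (labelMeasure V).real {σ | t ≤ σ v} = 1 - t := by
  have volume_Ici : (volume : Measure unitInterval).real (Set.Ici t) = 1 - t := by
    rw [Measure.real, unitInterval.volume_Ici, ENNReal.toReal_ofReal (sub_nonneg.2 t.2.2)]
  rw [← volume_Ici, ← map_eval_labelMeasure v,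
    map_measureReal_apply (measurable_pi_apply v) measurableSet_Ici]
  rfl

lemma setIntegral_Iio_unitInterval (g : ℝ → ℝ) (x : unitInterval) :
    ∫ t in Set.Iio x, g t = ∫ t in (0 : ℝ)..x, g t := by
  have Iio_inter_Icc : Set.Iio (x : ℝ) ∩ Set.Icc 0 1 = Set.Ico 0 (x : ℝ) := by
    ext t
    exact ⟨fun ht => ⟨ht.2.1, ht.1⟩, fun ht => ⟨ht.2, ht.1, ht.2.le.trans x.2.2⟩⟩
  rw [intervalIntegral.integral_of_le x.2.1, integral_Ioc_eq_integral_Ioo,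
    ← integral_Ico_eq_integral_Ioo, ← Iio_inter_Icc, ← Measure.restrict_restrict measurableSet_Iio]
  exact unitInterval.measurePreserving_coe.setIntegral_preimage_emb
    unitInterval.measurableEmbedding_coe g (Set.Iio (x : ℝ))

lemma integral_unitInterval (g : ℝ → ℝ) :
    ∫ t : unitInterval, g t = ∫ t in (0 : ℝ)..1, g t := by
  rw [intervalIntegral.integral_of_le zero_le_one, ← integral_Icc_eq_integral_Ioc]
  exact unitInterval.measurePreserving_coe.integral_comp unitInterval.measurableEmbedding_coe g

end RandomLabels

section OccupiedLabel

variable {V : Type*} (G : SimpleGraph V) (k : ℕ)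

/-- The label of `v` if `v` is occupied at round `k` (disregarding its neighbour `w`), and the top
label `1` otherwise, so that a vertex is occupied at the next round exactly when its label is at
most the occupied labels of its neighbours. -/
noncomputable def occupiedLabel (w v : V) (σ : V → unitInterval) : unitInterval :=
  open Classical in if IsOccupied G σ k w v then σ v else 1

variable {G k} in
lemma le_occupiedLabel_iff {w v : V} {σ : V → unitInterval} {t : unitInterval} :
    t ≤ occupiedLabel G k w v σ ↔ ¬ (σ v < t ∧ IsOccupied G σ k w v) := by
  unfold occupiedLabel
  split_ifs with h
  · simp [h]
  · simp [h, unitInterval.le_one']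

variable {G k} in
lemma isOccupied_succ_iff_le_inf [DecidableEq V] [G.LocallyFinite] {w v : V}
    {σ : V → unitInterval} :
    IsOccupied G σ (k + 1) w v ↔
      σ v ≤ ((G.neighborFinset v).erase w).inf fun u => occupiedLabel G k v u σ := by
  simp only [Finset.le_inf_iff, le_occupiedLabel_iff, Finset.mem_erase,
    SimpleGraph.mem_neighborFinset, IsOccupied]
  grind

variable [G.LocallyFinite]

lemma measurableSet_isOccupied (w v : V) :
    MeasurableSet {σ : V → unitInterval | IsOccupied G σ k w v} := by
  induction k generalizing w v with
  | zero => simp [IsOccupied]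
  | succ k ih =>
    have event_eq : {σ : V → unitInterval | IsOccupied G σ (k + 1) w v} =
        ⋂ u ∈ G.neighborFinset v, {_σ : V → unitInterval | u ≠ w}ᶜ ∪
          ({σ | σ u < σ v} ∩ {σ | IsOccupied G σ k v u})ᶜ := by
      ext σ
      simp only [IsOccupied, Set.mem_ofPred_eq, Set.mem_iInter, Set.mem_union, Set.mem_compl_iff,
        Set.mem_inter_iff, SimpleGraph.mem_neighborFinset]
      grind
    rw [event_eq]
    exact Finset.measurableSet_biInter _ fun u _ => (MeasurableSet.const _).compl.union
      ((measurableSet_lt (measurable_pi_apply u) (measurable_pi_apply v)).inter (ih v u)).compl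

lemma measurable_occupiedLabel (w v : V) : Measurable (occupiedLabel G k w v) := by
  classical
  exact Measurable.ite (measurableSet_isOccupied G k w v) (measurable_pi_apply v) measurable_const

end OccupiedLabel

section Branches

variable {V : Type*} {G : SimpleGraph V} {u u' v w : V}

/-- The vertices reached from `w` by a path whose first step leads to `v`. -/
def branch (G : SimpleGraph V) (w v : V) : Set V :=
  {z | ∃ (h : G.Adj w v) (p : G.Walk v z), (SimpleGraph.Walk.cons h p).IsPath}

lemma self_mem_branch (h : G.Adj w v) : v ∈ branch G w v := ⟨h, .nil, by simp [h.ne]⟩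

lemma notMem_branch : w ∉ branch G w v := by
  rintro ⟨h, p, hp⟩
  rw [SimpleGraph.Walk.cons_isPath_iff] at hp
  exact hp.2 p.end_mem_support

lemma branch_subset_branch (hG : G.IsAcyclic) (hwv : G.Adj w v) (hu : u ≠ w) :
    branch G v u ⊆ branch G w v := by
  rintro z ⟨hvu, p, hp⟩
  refine ⟨hwv, .cons hvu p, ?_⟩
  rw [hG.isPath_iff_isChain] at hp ⊢
  rw [SimpleGraph.Walk.edges_cons] at hp
  rw [SimpleGraph.Walk.edges_cons, SimpleGraph.Walk.edges_cons, List.isChain_cons_cons]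
  refine ⟨fun hedge => ?_, hp⟩
  rcases Sym2.eq_iff.1 hedge with ⟨h, -⟩ | ⟨h, -⟩
  exacts [hwv.ne h, hu h.symm]

lemma disjoint_branch (hG : G.IsAcyclic) (hne : u ≠ u') :
    Disjoint (branch G v u) (branch G v u') := by
  rw [Set.disjoint_left]
  rintro z ⟨h, p, hp⟩ ⟨h', p', hp'⟩
  have walk_eq := congrArg Subtype.val ((hG.subsingleton_path v z).elim ⟨_, hp⟩ ⟨_, hp'⟩)
  exact hne (by simpa only [SimpleGraph.Walk.snd_cons] using congrArg SimpleGraph.Walk.snd walk_eq)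

end Branches

section TreeLike

variable {V : Type*} {G : SimpleGraph V} {d k r : ℕ} {u v w ρ : V}

/-- The graph formed by the edges of `G` inside the ball of radius `r` around `ρ`; it is acyclic
when `G` looks like a tree from `ρ` up to distance `r`. -/
def ballGraph (G : SimpleGraph V) (ρ : V) (r : ℕ) : SimpleGraph V where
  Adj a b := G.Adj a b ∧ G.edist ρ a ≤ r ∧ G.edist ρ b ≤ r
  symm := ⟨fun _ _ h => ⟨h.1.symm, h.2.2, h.2.1⟩⟩
  loopless := ⟨fun _ h => h.1.ne rfl⟩

lemma edist_add_le_of_adj (hvu : G.Adj v u) (h : G.edist ρ v + (k + 1 : ℕ) ≤ r) :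
    G.edist ρ u + k ≤ r :=
  calc G.edist ρ u + k ≤ G.edist ρ v + G.edist v u + k := by gcongr; exact G.edist_triangle
    _ = G.edist ρ v + (k + 1 : ℕ) := by
      rw [SimpleGraph.edist_eq_one_iff_adj.2 hvu, add_assoc, add_comm 1 (k : ℕ∞)]
      rfl
    _ ≤ r := h

lemma dependsOn_occupiedLabel_branch (hG : (ballGraph G ρ r).IsAcyclic) (hwv : G.Adj w v)
    (hw : G.edist ρ w ≤ r) (hv : G.edist ρ v + k ≤ r) :
    DependsOn (occupiedLabel G k w v) (branch (ballGraph G ρ r) w v) := by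
  induction k generalizing w v with
  | zero =>
    intro σ τ h
    simpa [occupiedLabel, IsOccupied] using h v (self_mem_branch ⟨hwv, hw, by simpa using hv⟩)
  | succ k ih =>
    intro σ τ h
    have hv' : G.edist ρ v ≤ r := le_self_add.trans hv
    have hadj : (ballGraph G ρ r).Adj w v := ⟨hwv, hw, hv'⟩
    have label_eq : σ v = τ v := h v (self_mem_branch hadj)
    have children_eq (u : V) (hvu : G.Adj v u) (huw : u ≠ w) :
        occupiedLabel G k v u σ = occupiedLabel G k v u τ :=
      ih hvu hv' (edist_add_le_of_adj hvu hv) fun z hz => h z (branch_subset_branch hG hadj huw hz)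
    have occupied_iff : IsOccupied G σ (k + 1) w v ↔ IsOccupied G τ (k + 1) w v := by
      refine forall₃_congr fun u hvu huw => ?_
      rw [← not_and, ← not_and, ← le_occupiedLabel_iff, ← le_occupiedLabel_iff, label_eq,
        children_eq u hvu huw]
    by_cases hocc : IsOccupied G τ (k + 1) w v
    · rw [occupiedLabel, occupiedLabel, if_pos (occupied_iff.2 hocc), if_pos hocc, label_eq]
    · rw [occupiedLabel, occupiedLabel, if_neg (mt occupied_iff.1 hocc), if_neg hocc]

variable [G.LocallyFinite]

lemma measureReal_label_mem_and_isOccupied_succ [DecidableEq V]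
    (hG : (ballGraph G ρ r).IsAcyclic)
    (hv : G.edist ρ v + (k + 1 : ℕ) ≤ r) {F : ℝ → ℝ}
    (hF : ∀ u ∈ (G.neighborFinset v).erase w, ∀ t : unitInterval,
      (labelMeasure V).real {σ | t ≤ occupiedLabel G k v u σ} = F t)
    {B : Set unitInterval} (hB : MeasurableSet B) :
    (labelMeasure V).real {σ | σ v ∈ B ∧ IsOccupied G σ (k + 1) w v} =
      ∫ t in B, F t ^ ((G.neighborFinset v).erase w).card := by
  set children := (G.neighborFinset v).erase w
  have children_measurable : ∀ u ∈ children, Measurable (occupiedLabel G k v u) :=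
    fun u _ => measurable_occupiedLabel G k v u
  have children_dependsOn : ∀ u ∈ children,
      DependsOn (occupiedLabel G k v u) (branch (ballGraph G ρ r) v u) := fun u hu =>
    have hvu : G.Adj v u := by simpa using Finset.mem_of_mem_erase hu
    dependsOn_occupiedLabel_branch hG hvu (le_self_add.trans hv) (edist_add_le_of_adj hvu hv)
  have children_disjoint :
      (children : Set V).PairwiseDisjoint fun u => branch (ballGraph G ρ r) v u :=
    fun _ _ _ _ hne => disjoint_branch hG hne
  have indep : ProbabilityTheory.IndepFun (fun σ : V → unitInterval => σ v)
      (fun σ => children.inf fun u => occupiedLabel G k v u σ) (labelMeasure V) :=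
    indepFun_infinitePi_of_dependsOn (S := {v}) (measurable_pi_apply v)
      (measurable_finset_inf children_measurable) (fun _ _ h => h v rfl)
      (dependsOn_finset_inf children_dependsOn) (by simp [notMem_branch])
  simp_rw [isOccupied_succ_iff_le_inf]
  rw [measureReal_mem_and_le_of_indepFun (measurable_pi_apply v)
    (measurable_finset_inf children_measurable) indep hB, map_eval_labelMeasure]
  refine integral_congr_ae (Eventually.of_forall fun t => ?_)
  exact (measureReal_le_finset_inf_of_dependsOn children_measurable children_dependsOn
    children_disjoint t).trans (Finset.prod_eq_pow_card fun u hu => hF u hu t)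

lemma measureReal_le_occupiedLabel (hd : G.IsRegularOfDegree d)
    (hG : (ballGraph G ρ r).IsAcyclic) (hwv : G.Adj w v) (hv : G.edist ρ v + k ≤ r)
    (t : unitInterval) :
    (labelMeasure V).real {σ | t ≤ occupiedLabel G k w v σ} = picard (d - 1) k t := by
  classical
  induction k generalizing w v t with
  | zero => simpa [occupiedLabel, IsOccupied, picard] using measureReal_le_label v t
  | succ k ih =>
    have step := measureReal_label_mem_and_isOccupied_succ (w := w) hG hv (F := picard (d - 1) k)
      (fun u hu t => by
        have hvu : G.Adj v u := by simpa using Finset.mem_of_mem_erase hu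
        exact ih hvu (edist_add_le_of_adj hvu hv) t)
      (measurableSet_Iio (a := t))
    have event_measurable : MeasurableSet {σ | σ v ∈ Set.Iio t ∧ IsOccupied G σ (k + 1) w v} :=
      (measurable_pi_apply v measurableSet_Iio).inter (measurableSet_isOccupied G (k + 1) w v)
    have card_children : ((G.neighborFinset v).erase w).card = d - 1 := by
      rw [Finset.card_erase_of_mem (by simpa using hwv.symm),
        SimpleGraph.card_neighborFinset_eq_degree, hd v]
    have event_eq : {σ | t ≤ occupiedLabel G (k + 1) w v σ} =
        {σ | σ v ∈ Set.Iio t ∧ IsOccupied G σ (k + 1) w v}ᶜ := by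
      ext σ
      exact le_occupiedLabel_iff
    rw [event_eq, probReal_compl_eq_one_sub event_measurable, step, card_children,
      setIntegral_Iio_unitInterval (fun t => picard (d - 1) k t ^ (d - 1)), picard]

lemma measureReal_isOccupied_succ (hd : G.IsRegularOfDegree d)
    (hG : (ballGraph G ρ (k + 1)).IsAcyclic) :
    (labelMeasure V).real {σ | IsOccupied G σ (k + 1) ρ ρ} = treeOccupation d k := by
  classical
  have hρ : G.edist ρ ρ + (k + 1 : ℕ) ≤ (k + 1 : ℕ) := by simp
  have step := measureReal_label_mem_and_isOccupied_succ (w := ρ) hG hρ (F := picard (d - 1) k)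
    (fun u hu t => by
      have hρu : G.Adj ρ u := by simpa using Finset.mem_of_mem_erase hu
      exact measureReal_le_occupiedLabel hd hG hρu (edist_add_le_of_adj hρu hρ) t)
    MeasurableSet.univ
  have card_children : ((G.neighborFinset ρ).erase ρ).card = d := by
    rw [Finset.erase_eq_of_notMem (by simp), SimpleGraph.card_neighborFinset_eq_degree, hd ρ]
  rw [treeOccupation]
  simpa only [Set.mem_univ, true_and, setIntegral_univ, card_children,
    integral_unitInterval (fun t => picard (d - 1) k t ^ d)] using step

end TreeLike

/-! ### Balls and locality -/

section Balls

variable {V : Type*} {G : SimpleGraph V} {d : ℕ}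

lemma dependsOn_isOccupied {α : Type*} [LinearOrder α] (k : ℕ) (w v : V) :
    DependsOn (fun σ : V → α => IsOccupied G σ k w v) {z | G.edist v z ≤ k} := by
  induction k generalizing w v with
  | zero => exact fun _ _ _ => rfl
  | succ k ih =>
    intro σ τ h
    refine propext (forall₃_congr fun u hvu _ => ?_)
    have edist_le (z : V) (hz : G.edist u z ≤ k) : G.edist v z ≤ (k + 1 : ℕ) := by
      rw [Nat.cast_succ, add_comm, ← SimpleGraph.edist_eq_one_iff_adj.2 hvu]
      exact G.edist_triangle.trans (by gcongr)
    have occupied_eq : IsOccupied G σ k v u = IsOccupied G τ k v u :=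
      ih v u fun z hz => h z (edist_le z hz)
    rw [h v (by simp), h u (edist_le u (by simp)), occupied_eq]

variable [G.LocallyFinite]

lemma closedBall_succ_subset (v : V) (k : ℕ) :
    {z | G.edist v z ≤ (k + 1 : ℕ)} ⊆
      insert v (⋃ u ∈ G.neighborFinset v, {z | G.edist u z ≤ k}) := by
  intro z hz
  obtain ⟨p, hp⟩ := SimpleGraph.exists_walk_of_edist_ne_top
    (ne_top_of_le_ne_top (ENat.natCast_ne_top _) hz)
  cases p with
  | nil => exact Set.mem_insert _ _
  | @cons _ u _ hvu q =>
    rw [Set.mem_ofPred_eq, ← hp, SimpleGraph.Walk.length_cons, Nat.cast_le] at hz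
    refine Set.mem_insert_of_mem _ (Set.mem_biUnion (by simpa using hvu) ?_)
    exact (SimpleGraph.edist_le q).trans (Nat.cast_le.2 (Nat.le_of_succ_le_succ hz))

lemma finite_closedBall (v : V) (k : ℕ) : {z | G.edist v z ≤ k}.Finite := by
  classical
  induction k generalizing v with
  | zero => simp [SimpleGraph.edist_eq_zero_iff]
  | succ k ih =>
    exact (((Finset.finite_toSet _).biUnion fun u _ => ih u).insert v).subset
      (closedBall_succ_subset v k)

lemma ncard_closedBall_le (hd : ∀ v, G.degree v ≤ d) (v : V) (k : ℕ) :
    {z | G.edist v z ≤ k}.ncard ≤ (d + 1) ^ k := by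
  classical
  induction k generalizing v with
  | zero => simp [SimpleGraph.edist_eq_zero_iff]
  | succ k ih =>
    calc {z | G.edist v z ≤ (k + 1 : ℕ)}.ncard
        ≤ (insert v (⋃ u ∈ G.neighborFinset v, {z | G.edist u z ≤ k})).ncard :=
          Set.ncard_le_ncard (closedBall_succ_subset v k)
            (((Finset.finite_toSet _).biUnion fun u _ => finite_closedBall u k).insert v)
      _ ≤ (∑ u ∈ G.neighborFinset v, {z | G.edist u z ≤ k}.ncard) + 1 :=
          (Set.ncard_insert_le _ _).trans
            (Nat.add_le_add_right (Finset.set_ncard_biUnion_le _ _) 1)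
      _ ≤ d * (d + 1) ^ k + 1 := by
          gcongr
          refine (Finset.sum_le_card_nsmul _ _ _ fun u _ => ih u).trans ?_
          rw [SimpleGraph.card_neighborFinset_eq_degree, smul_eq_mul]
          exact Nat.mul_le_mul_right _ (hd v)
      _ ≤ (d + 1) ^ (k + 1) := by
          rw [pow_succ', add_one_mul]
          exact Nat.add_le_add_left (Nat.one_le_pow _ _ d.succ_pos) _

lemma countable_of_connected (hG : G.Connected) : Countable V := by
  obtain ⟨v⟩ := hG.nonempty
  have univ_eq : (Set.univ : Set V) = ⋃ k : ℕ, {z | G.edist v z ≤ k} := by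
    refine (Set.eq_univ_of_forall fun z => ?_).symm
    obtain ⟨p, hp⟩ := SimpleGraph.exists_walk_of_edist_ne_top
      (SimpleGraph.edist_ne_top_iff_reachable.2 (hG.preconnected v z))
    exact Set.mem_iUnion.2 ⟨p.length, hp.ge⟩
  rw [← Set.countable_univ_iff, univ_eq]
  exact Set.countable_iUnion fun k => (finite_closedBall v k).countable

end Balls

/-! ### The order of the labels -/

section LabelOrder

lemma ae_injective_label {V : Type*} [Countable V] :
    ∀ᵐ σ ∂(labelMeasure V), Function.Injective σ := by
  have ae_ne_pair : ∀ᵐ q ∂((volume : Measure unitInterval).prod volume), q.1 ≠ q.2 :=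
    (Measure.ae_prod_iff_ae_ae measurableSet_diagonal.compl).2
      (ae_of_all _ fun x => (Measure.ae_ne volume x).mono fun _ => Ne.symm)
  have ae_label_ne (u v : V) (huv : u ≠ v) : ∀ᵐ σ ∂(labelMeasure V), σ u ≠ σ v := by
    rw [← Measure.infinitePi_map_eval_prod (P := fun _ : V => (volume : Measure unitInterval)) huv]
      at ae_ne_pair
    exact ae_of_ae_map
      ((measurable_pi_apply u).prodMk (measurable_pi_apply v)).aemeasurable ae_ne_pair
  have ae_label_ne' : ∀ᵐ σ ∂(labelMeasure V), ∀ u v, u ≠ v → σ u ≠ σ v := by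
    simpa only [ae_all_iff, Filter.eventually_imp_distrib_left] using ae_label_ne
  exact ae_label_ne'.mono fun σ hσ u v => not_imp_not.1 (hσ u v)

lemma eq_of_strictMono_comp {α : Type*} [LinearOrder α] {m : ℕ} {f : Fin m → α}
    {e e' : Equiv.Perm (Fin m)} (he : StrictMono (f ∘ e)) (he' : StrictMono (f ∘ e')) :
    e = e' := by
  have hf : Function.Injective f := he.injective.of_comp_right e.surjective
  have comp_eq : f ∘ e = f ∘ e' := (he.range_inj he').1 (by
    rw [e.surjective.range_comp, e'.surjective.range_comp])
  exact Equiv.ext fun i => hf (congrFun comp_eq i)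

variable {V : Type*} {m : ℕ} {f : Fin m → V}

lemma measurableSet_strictMono_label (f : Fin m → V) :
    MeasurableSet {σ : V → unitInterval | StrictMono (σ ∘ f)} := by
  have event_eq : {σ : V → unitInterval | StrictMono (σ ∘ f)} =
      ⋂ (i : Fin m) (j : Fin m) (_ : i < j), {σ | σ (f i) < σ (f j)} := by
    ext σ
    simp [StrictMono]
  rw [event_eq]
  exact .iInter fun i => .iInter fun j => .iInter fun _ =>
    measurableSet_lt (measurable_pi_apply (f i)) (measurable_pi_apply (f j))

lemma measureReal_strictMono_label_perm (hf : Function.Injective f) (e : Equiv.Perm (Fin m)) :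
    (labelMeasure V).real {σ | StrictMono (σ ∘ f ∘ e)} =
      (labelMeasure V).real {σ | StrictMono (σ ∘ f)} := by
  have measureReal_eq {g : Fin m → V} (hg : Function.Injective g) :
      (labelMeasure V).real {σ | StrictMono (σ ∘ g)} =
        (labelMeasure (Fin m)).real {σ | StrictMono σ} := by
    have measurable_comp : Measurable fun σ : V → unitInterval => σ ∘ g :=
      measurable_pi_iff.2 fun i => measurable_pi_apply (g i)
    have measurable_event : MeasurableSet {σ : Fin m → unitInterval | StrictMono σ} :=
      measurableSet_strictMono_label id
    rw [← map_comp_labelMeasure hg, map_measureReal_apply measurable_comp measurable_event]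
    rfl
  rw [measureReal_eq (hf.comp e.injective), measureReal_eq hf]

lemma measureReal_strictMono_label_le (f : Fin m → V) :
    (labelMeasure V).real {σ | StrictMono (σ ∘ f)} ≤ 1 / m.factorial := by
  by_cases hf : Function.Injective f
  · have sum_perm := measureReal_biUnion_finset (μ := labelMeasure V) (s := Finset.univ)
      (f := fun e : Equiv.Perm (Fin m) => {σ : V → unitInterval | StrictMono (σ ∘ f ∘ e)})
      (fun e _ e' _ hne => Set.disjoint_left.2 fun σ he he' =>
        hne (eq_of_strictMono_comp (f := σ ∘ f) he he'))
      (fun e _ => measurableSet_strictMono_label (f ∘ e))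
    simp only [measureReal_strictMono_label_perm hf, Finset.sum_const, Finset.card_univ,
      Fintype.card_perm, Fintype.card_fin, nsmul_eq_mul] at sum_perm
    rw [le_div_iff₀ (by positivity), mul_comm, ← sum_perm]
    exact measureReal_le_one
  · have event_eq : {σ : V → unitInterval | StrictMono (σ ∘ f)} = ∅ :=
      Set.eq_empty_of_forall_notMem fun σ hσ => hf hσ.injective.of_comp
    rw [event_eq, measureReal_empty]
    positivity

lemma measureReal_strictAnti_label_le (f : Fin m → V) :
    (labelMeasure V).real {σ | StrictAnti (σ ∘ f)} ≤ 1 / m.factorial := by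
  refine (measureReal_mono fun σ hσ => ?_).trans (measureReal_strictMono_label_le (f ∘ Fin.rev))
  exact hσ.comp Fin.rev_strictAnti

end LabelOrder

/-! ### Nonexplosive growth -/

section NonexplosiveGrowth

variable {V : Type*} {G : SimpleGraph V} [G.LocallyFinite] {d : ℕ} {v : V}

/-- The sequences of vertices visited by the walks of length `k` which start at `v`. -/
noncomputable def walkSeqs (G : SimpleGraph V) [G.LocallyFinite] :
    (k : ℕ) → V → Finset (Fin (k + 1) → V)
  | 0, v => {fun _ => v}
  | k + 1, v => open Classical in
      (G.neighborFinset v).biUnion fun u => (walkSeqs G k u).image (Matrix.vecCons v)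

lemma card_walkSeqs_le (hd : ∀ v, G.degree v ≤ d) (k : ℕ) (v : V) :
    (walkSeqs G k v).card ≤ d ^ k := by
  classical
  induction k generalizing v with
  | zero => simp [walkSeqs]
  | succ k ih =>
    rw [pow_succ']
    refine (Finset.card_biUnion_le_card_mul _ _ _
      fun u _ => Finset.card_image_le.trans (ih u)).trans ?_
    exact Nat.mul_le_mul_right _ (hd v)

lemma exists_infinite_past_of_infinite_past {σ : V → unitInterval} (h : (past G σ v).Infinite) :
    ∃ u, G.Adj v u ∧ σ u < σ v ∧ (past G σ u).Infinite := by
  by_contra! finite_past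
  have finite_smaller : {u | G.Adj v u ∧ σ u < σ v}.Finite :=
    (G.neighborFinset v).finite_toSet.subset fun u hu => by simpa using hu.1
  have past_subset : past G σ v ⊆ insert v (⋃ u ∈ {u | G.Adj v u ∧ σ u < σ v}, past G σ u) := by
    intro z hz
    rcases Relation.ReflTransGen.cases_head hz with rfl | ⟨u, hu, huz⟩
    · exact Set.mem_insert _ _
    · exact Set.mem_insert_of_mem _ (Set.mem_biUnion hu huz)
  exact h (((finite_smaller.biUnion fun u hu => finite_past u hu.1 hu.2).insert v).subset
    past_subset)

lemma exists_strictAnti_of_infinite_past {σ : V → unitInterval} (h : (past G σ v).Infinite)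
    (k : ℕ) : ∃ f ∈ walkSeqs G k v, f 0 = v ∧ StrictAnti (σ ∘ f) := by
  classical
  induction k generalizing v with
  | zero => exact ⟨fun _ => v, by simp [walkSeqs], rfl, Subsingleton.strictAnti (α := Fin 1) _⟩
  | succ k ih =>
    obtain ⟨u, hvu, hlt, hu⟩ := exists_infinite_past_of_infinite_past h
    obtain ⟨f, hf, rfl, hanti⟩ := ih hu
    refine ⟨Matrix.vecCons v f, Finset.mem_biUnion.2 ⟨f 0, by simpa using hvu,
      Finset.mem_image_of_mem _ hf⟩, rfl, ?_⟩
    have comp_vecCons : σ ∘ Matrix.vecCons v f = Matrix.vecCons (σ v) (σ ∘ f) := Fin.comp_cons σ v f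
    rw [comp_vecCons]
    exact strictAnti_vecCons.2 ⟨hlt, hanti⟩

lemma measureReal_infinite_past_le (hd : ∀ v, G.degree v ≤ d) (v : V) (k : ℕ) :
    (labelMeasure V).real {σ | (past G σ v).Infinite} ≤ d ^ k / k.factorial :=
  calc (labelMeasure V).real {σ | (past G σ v).Infinite}
      ≤ (labelMeasure V).real (⋃ f ∈ walkSeqs G k v, {σ | StrictAnti (σ ∘ f)}) := by
        refine measureReal_mono (fun σ hσ => ?_) (measure_ne_top _ _)
        obtain ⟨f, hf, -, hanti⟩ := exists_strictAnti_of_infinite_past hσ k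
        exact Set.mem_biUnion hf hanti
    _ ≤ ∑ f ∈ walkSeqs G k v, (labelMeasure V).real {σ | StrictAnti (σ ∘ f)} :=
        measureReal_biUnion_finset_le _ _
    _ ≤ (walkSeqs G k v).card • (1 / (k + 1).factorial : ℝ) :=
        Finset.sum_le_card_nsmul _ _ _ fun f _ => measureReal_strictAnti_label_le f
    _ ≤ d ^ k / k.factorial := by
        rw [nsmul_eq_mul, mul_one_div]
        gcongr
        exacts [mod_cast card_walkSeqs_le hd k v, k.le_succ]

theorem nonexplosiveGrowth_of_degree_le (hd : ∀ v, G.degree v ≤ d) (v : V) :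
    NonexplosiveGrowth G v := by
  have measureReal_le_zero : (labelMeasure V).real {σ | (past G σ v).Infinite} ≤ 0 :=
    ge_of_tendsto' (FloorSemiring.tendsto_pow_div_factorial_atTop (d : ℝ))
      (measureReal_infinite_past_le hd v)
  exact (measureReal_eq_zero_iff).1 (measureReal_le_zero.antisymm measureReal_nonneg)

end NonexplosiveGrowth

/-! ### The regular tree -/

section Tree

variable {V : Type*} {G : SimpleGraph V} {σ : V → unitInterval} {d : ℕ} {ρ : V}

lemma nodup_labelOrder {W : Type*} [Fintype W] (τ : W → unitInterval) : (labelOrder τ).Nodup :=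
  (List.mergeSort_perm _ _).nodup_iff.2 (Finset.nodup_toList _)

lemma pairwise_labelOrder {W : Type*} [Fintype W] (τ : W → unitInterval) :
    (labelOrder τ).Pairwise (fun u v => τ u ≤ τ v) := by
  have sorted := List.pairwise_mergeSort (le := fun u v => decide (τ u ≤ τ v))
    (fun _ _ _ => by simpa only [decide_eq_true_eq] using le_trans)
    (fun u v => by simpa using le_total (τ u) (τ v)) (Finset.univ : Finset W).toList
  simpa only [decide_eq_true_eq, labelOrder] using sorted

lemma IsGreedySolution.of_induce {P : Set V} {J : Set P}
    (hP : ∀ v ∈ P, ∀ u, G.Adj v u → σ u < σ v → u ∈ P)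
    (h : IsGreedySolution (G.induce P) (fun v => σ v) Set.univ J) :
    IsGreedySolution G σ P (Subtype.val '' J) := by
  refine ⟨hP, fun v hv => ?_⟩
  have mem_image_iff (u : V) (hu : u ∈ P) : u ∈ Subtype.val '' J ↔ ⟨u, hu⟩ ∈ J := by simp [hu]
  rw [mem_image_iff v hv, h.mem_iff ⟨v, hv⟩ (Set.mem_univ _)]
  refine ⟨fun H u hvu hlt huJ => ?_, fun H u hvu hlt huJ => H u hvu hlt ⟨u, huJ, rfl⟩⟩
  have hu : u ∈ P := hP v hv u hvu hlt
  exact H ⟨u, hu⟩ hvu hlt ((mem_image_iff u hu).1 huJ)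

lemma exists_isGreedySolution_past (hfin : (past G σ ρ).Finite) (hσ : Function.Injective σ) :
    ∃ J, IsGreedySolution G σ (past G σ ρ) J ∧ (σ ∈ rootOccupied G ρ ↔ ρ ∈ J) := by
  let := hfin.fintype
  have isGreedySolution := isGreedySolution_greedyMIS (G := G.induce (past G σ ρ))
    (nodup_labelOrder fun v : past G σ ρ => σ v) (fun v => by simp [labelOrder])
    (pairwise_labelOrder _) (fun u v huv h => huv.ne (Subtype.ext (hσ h)))
  refine ⟨_, isGreedySolution.of_induce fun v hv u hvu hlt => hv.tail ⟨hvu, hlt⟩, ?_⟩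
  refine ⟨fun ⟨_, h⟩ => ⟨_, h, rfl⟩, ?_⟩
  rintro ⟨v, h, hv⟩
  obtain rfl : v = ⟨ρ, .refl⟩ := Subtype.ext hv
  exact ⟨hfin, h⟩

lemma mem_rootOccupied_of_isOccupied_odd (hfin : (past G σ ρ).Finite) (hσ : Function.Injective σ)
    {k : ℕ} (hocc : IsOccupied G σ (2 * k + 1) ρ ρ) : σ ∈ rootOccupied G ρ := by
  obtain ⟨J, hJ, mem_iff⟩ := exists_isGreedySolution_past hfin hσ
  exact mem_iff.2 (hJ.mem_of_isOccupied_odd .refl hocc)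

lemma isOccupied_even_of_mem_rootOccupied (hfin : (past G σ ρ).Finite)
    (hσ : Function.Injective σ) (hρ : σ ∈ rootOccupied G ρ) (k : ℕ) :
    IsOccupied G σ (2 * k) ρ ρ := by
  obtain ⟨J, hJ, mem_iff⟩ := exists_isGreedySolution_past hfin hσ
  exact hJ.isOccupied_even .refl (mem_iff.1 hρ) k

theorem greedyDensity_eq_greedyLimit [G.LocallyFinite] (hd : 3 ≤ d) (hG : G.IsTree)
    (hreg : G.IsRegularOfDegree d) (ρ : V) : greedyDensity G ρ = greedyLimit d := by
  have := countable_of_connected hG.connected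
  have occupation (k : ℕ) :
      (labelMeasure V).real {σ | IsOccupied G σ (k + 1) ρ ρ} = treeOccupation d k :=
    measureReal_isOccupied_succ hreg (hG.isAcyclic.anti fun _ _ h => h.1)
  have past_finite := nonexplosiveGrowth_of_degree_le (fun v => (hreg v).le) ρ
  have hlim := tendsto_treeOccupation hd
  refine le_antisymm ?_ ?_
  · refine ge_of_tendsto' (hlim.comp (tendsto_atTop_mono (fun k => by omega : ∀ k, k ≤ 2 * k + 1)
      tendsto_id)) fun k => ?_
    rw [Function.comp_apply, ← occupation]
    refine ENNReal.toReal_mono (measure_ne_top _ _) (measure_mono_ae ?_)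
    filter_upwards [past_finite, ae_injective_label] with σ hfin hσ hρ
    exact isOccupied_even_of_mem_rootOccupied hfin hσ hρ (k + 1)
  · refine le_of_tendsto' (hlim.comp (tendsto_atTop_mono (fun k => by omega : ∀ k, k ≤ 2 * k)
      tendsto_id)) fun k => ?_
    rw [Function.comp_apply, ← occupation]
    refine ENNReal.toReal_mono (measure_ne_top _ _) (measure_mono_ae ?_)
    filter_upwards [past_finite, ae_injective_label] with σ hfin hσ hocc
    exact mem_rootOccupied_of_isOccupied_odd hfin hσ hocc

end Tree

/-! ### Concentration of the number of occupied vertices -/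

section Chebyshev

open ProbabilityTheory

lemma sum_indicator_one_eq_ncard {ι : Type*} [Fintype ι] (s : Set ι) :
    ∑ i, s.indicator (1 : ι → ℝ) i = s.ncard := by
  classical
  simp only [Set.indicator_apply, Pi.one_apply, Finset.sum_boole, Set.ncard_eq_toFinset_card',
    Set.filter_mem_univ_eq_toFinset]

variable {Ω ι : Type*} [MeasurableSpace Ω] {μ : Measure Ω} [IsProbabilityMeasure μ]

lemma memLp_indicator_one {A : Set Ω} (hA : MeasurableSet A) (p : ENNReal) :
    MemLp (A.indicator (1 : Ω → ℝ)) p μ :=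
  memLp_indicator_const p hA 1 (Or.inr (measure_ne_top μ A))

lemma covariance_indicator_one {A B : Set Ω} (hA : MeasurableSet A) (hB : MeasurableSet B) :
    cov[A.indicator 1, B.indicator 1; μ] = μ.real (A ∩ B) - μ.real A * μ.real B := by
  rw [covariance_eq_sub (memLp_indicator_one hA 2) (memLp_indicator_one hB 2),
    ← Set.inter_indicator_one, integral_indicator_one (hA.inter hB), integral_indicator_one hA,
    integral_indicator_one hB]

variable [Fintype ι] {A : ι → Set Ω} {N : ι → Set ι} {D : ℕ}

lemma variance_sum_indicator_le (hA : ∀ i, MeasurableSet (A i)) (hN : ∀ i, (N i).ncard ≤ D)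
    (hindep : ∀ i, ∀ j ∉ N i, μ.real (A i ∩ A j) = μ.real (A i) * μ.real (A j)) :
    Var[fun ω => ∑ i, (A i).indicator 1 ω; μ] ≤ Fintype.card ι * D := by
  classical
  have covariance_le (i j : ι) :
      cov[(A i).indicator 1, (A j).indicator 1; μ] ≤ (N i).indicator 1 j := by
    rw [covariance_indicator_one (hA i) (hA j)]
    by_cases hj : j ∈ N i
    · rw [Set.indicator_of_mem hj]
      exact (sub_le_self _ (by positivity)).trans measureReal_le_one
    · rw [Set.indicator_of_notMem hj, hindep i j hj, sub_self]
  rw [variance_fun_sum fun i => memLp_indicator_one (hA i) 2]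
  calc ∑ i, ∑ j, cov[(A i).indicator 1, (A j).indicator 1; μ]
      ≤ ∑ i, ∑ j, (N i).indicator (1 : ι → ℝ) j :=
        Finset.sum_le_sum fun i _ => Finset.sum_le_sum fun j _ => covariance_le i j
    _ = ∑ i, ((N i).ncard : ℝ) :=
        Finset.sum_congr rfl fun i _ => sum_indicator_one_eq_ncard (N i)
    _ ≤ ∑ _i : ι, (D : ℝ) := Finset.sum_le_sum fun i _ => Nat.cast_le.2 (hN i)
    _ = Fintype.card ι * D := by simp

lemma measureReal_le_abs_sum_indicator_sub_le (hA : ∀ i, MeasurableSet (A i))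
    (hN : ∀ i, (N i).ncard ≤ D)
    (hindep : ∀ i, ∀ j ∉ N i, μ.real (A i ∩ A j) = μ.real (A i) * μ.real (A j))
    {t : ℝ} (ht : 0 < t) :
    μ.real {ω | t ≤ |∑ i, (A i).indicator 1 ω - ∑ i, μ.real (A i)|} ≤
      Fintype.card ι * D / t ^ 2 := by
  have chebyshev := meas_ge_le_variance_div_sq
    (memLp_finsetSum Finset.univ fun i _ => memLp_indicator_one (μ := μ) (hA i) 2) ht
  have integral_eq : ∫ ω, ∑ i, (A i).indicator (1 : Ω → ℝ) ω ∂μ = ∑ i, μ.real (A i) := by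
    rw [integral_finsetSum _ fun i _ => (memLp_indicator_one (hA i) 1).integrable le_rfl]
    exact Finset.sum_congr rfl fun i _ => integral_indicator_one (hA i)
  rw [integral_eq] at chebyshev
  refine (ENNReal.toReal_le_of_le_ofReal (div_nonneg (variance_nonneg _ _) (sq_nonneg t))
    chebyshev).trans ?_
  gcongr
  exact variance_sum_indicator_le hA hN hindep

end Chebyshev

section OccupiedCount

variable {V : Type*} {G : SimpleGraph V} {d : ℕ} {k : ℕ} {u v : V}

/-- The number of vertices which are occupied at round `k` of the greedy recursion. -/
noncomputable def occupiedCount (G : SimpleGraph V) (σ : V → unitInterval) (k : ℕ) : ℕ :=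
  {v | IsOccupied G σ k v v}.ncard

variable [G.LocallyFinite]

lemma measureReal_isOccupied_inter (huv : ¬ G.edist u v ≤ (2 * k : ℕ)) :
    (labelMeasure V).real ({σ | IsOccupied G σ k u u} ∩ {σ | IsOccupied G σ k v v}) =
      (labelMeasure V).real {σ | IsOccupied G σ k u u} *
        (labelMeasure V).real {σ | IsOccupied G σ k v v} := by
  have disjoint_balls : Disjoint {z | G.edist u z ≤ k} {z | G.edist v z ≤ k} := by
    refine Set.disjoint_left.2 fun z hu hv => huv ((G.edist_triangle (v := z)).trans ?_)
    rw [two_mul, Nat.cast_add, G.edist_comm (u := z)]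
    exact add_le_add hu hv
  have indep := indepFun_infinitePi_of_dependsOn
    (P := fun _ : V => (volume : Measure unitInterval))
    (measurableSet_setOfPred.1 (measurableSet_isOccupied G k u u))
    (measurableSet_setOfPred.1 (measurableSet_isOccupied G k v v))
    (dependsOn_isOccupied k u u) (dependsOn_isOccupied k v v) disjoint_balls
  have measure_inter := indep.measure_inter_preimage_eq_mul {True} {True} trivial trivial
  simpa [Measure.real, Set.preimage] using! congrArg ENNReal.toReal measure_inter

lemma measureReal_le_abs_occupiedCount_sub_le [Fintype V] (hd : ∀ v, G.degree v ≤ d) (k : ℕ)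
    {t : ℝ} (ht : 0 < t) :
    (labelMeasure V).real {σ | t ≤ |(occupiedCount G σ k : ℝ) -
      ∑ v, (labelMeasure V).real {σ | IsOccupied G σ k v v}|} ≤
        Fintype.card V * (d + 1) ^ (2 * k) / t ^ 2 := by
  have occupiedCount_eq (σ : V → unitInterval) :
      (occupiedCount G σ k : ℝ) = ∑ v, {σ | IsOccupied G σ k v v}.indicator 1 σ :=
    (sum_indicator_one_eq_ncard _).symm
  simp_rw [occupiedCount_eq]
  exact_mod_cast measureReal_le_abs_sum_indicator_sub_le
    (fun v => measurableSet_isOccupied G k v v) (fun v => ncard_closedBall_le hd v (2 * k))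
    (fun u v huv => measureReal_isOccupied_inter huv) ht

end OccupiedCount

/-! ### Uniformly random orderings -/

section VertexOrder

variable {V : Type*} [Fintype V] {G : SimpleGraph V} {σ : V → unitInterval} {π : VertexOrder V}

lemma exists_strictMono_comp_vertexOrder (hσ : Function.Injective σ) :
    ∃ π : VertexOrder V, StrictMono (σ ∘ π) := by
  set e : VertexOrder V := (Fintype.equivFin V).symm
  exact ⟨(Tuple.sort (σ ∘ e)).trans e, (Tuple.monotone_sort (σ ∘ e)).strictMono_of_injective
    ((hσ.comp e.injective).comp (Equiv.injective _))⟩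

lemma measureReal_le_uniformProb_vertexOrder {A : Set (V → unitInterval)}
    {p : VertexOrder V → Prop}
    (hA : ∀ σ ∈ A, ∀ π : VertexOrder V, StrictMono (σ ∘ π) → p π) :
    (labelMeasure V).real A ≤ uniformProb (VertexOrder V) p := by
  classical
  set good : Finset (VertexOrder V) := {π | p π}
  have ae_subset : A ≤ᵐ[labelMeasure V] ⋃ π ∈ good, {σ | StrictMono (σ ∘ π)} := by
    filter_upwards [ae_injective_label (V := V)] with σ hσ hσA
    obtain ⟨π, hπ⟩ := exists_strictMono_comp_vertexOrder hσ
    exact Set.mem_biUnion (by simpa [good] using hA σ hσA π hπ) hπ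
  calc (labelMeasure V).real A
      ≤ (labelMeasure V).real (⋃ π ∈ good, {σ | StrictMono (σ ∘ π)}) :=
        ENNReal.toReal_mono (measure_ne_top _ _) (measure_mono_ae ae_subset)
    _ ≤ ∑ π ∈ good, (labelMeasure V).real {σ | StrictMono (σ ∘ π)} :=
        measureReal_biUnion_finset_le _ _
    _ ≤ good.card • (1 / (Fintype.card V).factorial : ℝ) :=
        Finset.sum_le_card_nsmul _ _ _ fun π _ => measureReal_strictMono_label_le π
    _ = uniformProb (VertexOrder V) p := by
        rw [uniformProb, Nat.card_eq_fintype_card, Nat.card_eq_fintype_card, Fintype.card_subtype,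
          Fintype.card_equiv (Fintype.equivFin V).symm, Fintype.card_fin, nsmul_eq_mul,
          mul_one_div]

lemma isGreedySolution_greedyMIS_ofFn (hπ : StrictMono (σ ∘ π)) :
    IsGreedySolution G σ Set.univ (greedyMIS G (List.ofFn π)) := by
  have hσ : Function.Injective σ := hπ.injective.of_comp_right π.surjective
  exact isGreedySolution_greedyMIS (List.nodup_ofFn.2 π.injective)
    (fun v => List.mem_ofFn.2 (π.surjective v))
    (List.pairwise_ofFn.2 fun _ _ h => (hπ h).le) (fun _ _ huv h => huv.ne (hσ h))

variable [Nonempty V] (hπ : StrictMono (σ ∘ π)) (k : ℕ)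
include hπ

lemma greedyRatio_mul_card_le_occupiedCount :
    greedyRatio G π * Fintype.card V ≤ occupiedCount G σ (2 * k) := by
  rw [greedyRatio, div_mul_cancel₀ _ (by simp)]
  refine Nat.cast_le.2 (Set.ncard_le_ncard fun v hv => ?_)
  exact (isGreedySolution_greedyMIS_ofFn hπ).isOccupied_even (Set.mem_univ v) hv k

lemma occupiedCount_le_greedyRatio_mul_card :
    occupiedCount G σ (2 * k + 1) ≤ greedyRatio G π * Fintype.card V := by
  rw [greedyRatio, div_mul_cancel₀ _ (by simp)]
  refine Nat.cast_le.2 (Set.ncard_le_ncard fun v hv => ?_)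
  exact (isGreedySolution_greedyMIS_ofFn hπ).mem_of_isOccupied_odd (Set.mem_univ v) hv

lemma abs_greedyRatio_sub_lt {c ε t₀ t₁ : ℝ}
    (hodd : |(occupiedCount G σ (2 * k + 1) : ℝ) - Fintype.card V * t₀| < 2 * ε * Fintype.card V)
    (heven : |(occupiedCount G σ (2 * k + 2) : ℝ) - Fintype.card V * t₁| < 2 * ε * Fintype.card V)
    (ht₀ : |t₀ - c| < ε) (ht₁ : |t₁ - c| < ε) : |greedyRatio G π - c| < 3 * ε := by
  have hn : 0 < (Fintype.card V : ℝ) := Nat.cast_pos.2 Fintype.card_pos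
  have lower : (c - 3 * ε) * Fintype.card V < greedyRatio G π * Fintype.card V := by
    have := mul_lt_mul_of_pos_right (abs_lt.1 ht₀).1 hn
    linarith [(abs_lt.1 hodd).1, occupiedCount_le_greedyRatio_mul_card (G := G) hπ k]
  have upper : greedyRatio G π * Fintype.card V < (c + 3 * ε) * Fintype.card V := by
    have := mul_lt_mul_of_pos_right (abs_lt.1 ht₁).2 hn
    have ratio_le : greedyRatio G π * Fintype.card V ≤ occupiedCount G σ (2 * k + 2) :=
      greedyRatio_mul_card_le_occupiedCount hπ (k + 1)
    linarith [(abs_lt.1 heven).2]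
  rw [abs_lt]
  exact ⟨by linarith [lt_of_mul_lt_mul_right lower hn.le],
    by linarith [lt_of_mul_lt_mul_right upper hn.le]⟩

end VertexOrder

/-! ### Finite graphs with few short cycles -/

section CyclicCount

/-- The number of vertices around which the ball of radius `r` contains a cycle. -/
noncomputable def cyclicCount {V : Type*} (G : SimpleGraph V) (r : ℕ) : ℕ :=
  {v | ¬ (ballGraph G v r).IsAcyclic}.ncard

lemma ballGraph_mono {V : Type*} (G : SimpleGraph V) (v : V) : Monotone (ballGraph G v) :=
  fun _ _ h _ _ hab => ⟨hab.1, hab.2.1.trans (by gcongr), hab.2.2.trans (by gcongr)⟩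

lemma cyclicCount_mono {V : Type*} [Finite V] (G : SimpleGraph V) : Monotone (cyclicCount G) :=
  fun _ _ h => Set.ncard_le_ncard fun v hv hac => hv (hac.anti (ballGraph_mono G v h))

lemma treeOccupation_mem_Icc (d k : ℕ) : treeOccupation d k ∈ Set.Icc (0 : ℝ) 1 := by
  have pow_mem_Icc (t : ℝ) (ht : t ∈ Set.Icc (0 : ℝ) 1) :
      picard (d - 1) k t ^ d ∈ Set.Icc (0 : ℝ) 1 :=
    have h := picard_mem_Icc (d - 1) k ht
    ⟨pow_nonneg h.1 d, pow_le_one₀ h.1 h.2⟩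
  refine ⟨intervalIntegral.integral_nonneg zero_le_one fun t ht => (pow_mem_Icc t ht).1, ?_⟩
  calc treeOccupation d k ≤ ∫ _t in (0 : ℝ)..1, (1 : ℝ) :=
        intervalIntegral.integral_mono_on zero_le_one
          (((continuous_picard (d - 1) k).pow d).intervalIntegrable 0 1)
          (continuous_const.intervalIntegrable 0 1) fun t ht => (pow_mem_Icc t ht).2
    _ = 1 := by simp

variable {V : Type*} [Fintype V] {G : SimpleGraph V} [G.LocallyFinite] {d k : ℕ} {ε : ℝ}

lemma abs_sum_measureReal_isOccupied_sub_le (hd : G.IsRegularOfDegree d) (k : ℕ) :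
    |∑ v, (labelMeasure V).real {σ | IsOccupied G σ (k + 1) v v} -
      Fintype.card V * treeOccupation d k| ≤ cyclicCount G (k + 1) := by
  have abs_sub_le (v : V) :
      |(labelMeasure V).real {σ | IsOccupied G σ (k + 1) v v} - treeOccupation d k| ≤
        {v | ¬ (ballGraph G v (k + 1)).IsAcyclic}.indicator 1 v := by
    by_cases hv : (ballGraph G v (k + 1)).IsAcyclic
    · simp [measureReal_isOccupied_succ hd hv, hv]
    · rw [Set.indicator_of_mem hv]
      have ht := treeOccupation_mem_Icc d k
      exact abs_sub_le_of_nonneg_of_le measureReal_nonneg measureReal_le_one ht.1 ht.2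
  rw [cyclicCount, ← sum_indicator_one_eq_ncard, ← nsmul_eq_mul, ← Finset.card_univ,
    ← Finset.sum_const, ← Finset.sum_sub_distrib]
  exact (Finset.abs_sum_le_sum_abs _ _).trans (Finset.sum_le_sum fun v _ => abs_sub_le v)

lemma measureReal_le_abs_occupiedCount_sub_treeOccupation_le [Nonempty V]
    (hd : G.IsRegularOfDegree d) (hε : 0 < ε) (hG : cyclicCount G (k + 1) ≤ ε * Fintype.card V) :
    (labelMeasure V).real {σ | 2 * ε * Fintype.card V ≤
      |occupiedCount G σ (k + 1) - Fintype.card V * treeOccupation d k|} ≤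
        (d + 1) ^ (2 * (k + 1)) / ε ^ 2 / Fintype.card V := by
  have hn : 0 < (Fintype.card V : ℝ) := Nat.cast_pos.2 Fintype.card_pos
  have expectation_near := (abs_sum_measureReal_isOccupied_sub_le hd k).trans hG
  calc (labelMeasure V).real {σ | 2 * ε * Fintype.card V ≤
        |occupiedCount G σ (k + 1) - Fintype.card V * treeOccupation d k|}
      ≤ (labelMeasure V).real {σ | ε * Fintype.card V ≤ |(occupiedCount G σ (k + 1) : ℝ) -
          ∑ v, (labelMeasure V).real {σ | IsOccupied G σ (k + 1) v v}|} := by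
        refine measureReal_mono fun σ hσ => ?_
        have triangle := hσ.trans (abs_sub_le _
          (∑ v, (labelMeasure V).real {σ | IsOccupied G σ (k + 1) v v}) _)
        exact (by linarith : ε * Fintype.card V ≤ _)
    _ ≤ Fintype.card V * (d + 1) ^ (2 * (k + 1)) / (ε * Fintype.card V) ^ 2 :=
        measureReal_le_abs_occupiedCount_sub_le (fun v => (hd v).le) (k + 1) (mul_pos hε hn)
    _ = (d + 1) ^ (2 * (k + 1)) / ε ^ 2 / Fintype.card V := by
        field_simp

lemma one_sub_le_uniformProb_abs_greedyRatio_sub_lt [Nonempty V] {c : ℝ}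
    (hd : G.IsRegularOfDegree d) (hε : 0 < ε) (hG : cyclicCount G (2 * k + 2) ≤ ε * Fintype.card V)
    (hodd : |treeOccupation d (2 * k) - c| < ε) (heven : |treeOccupation d (2 * k + 1) - c| < ε) :
    1 - 2 * ((d + 1) ^ (4 * k + 4) / ε ^ 2) / Fintype.card V ≤
      uniformProb (VertexOrder V) (fun π => |greedyRatio G π - c| < 3 * ε) := by
  set far : ℕ → Set (V → unitInterval) := fun j =>
    {σ | 2 * ε * Fintype.card V ≤
      |(occupiedCount G σ (j + 1) : ℝ) - Fintype.card V * treeOccupation d j|} with far_def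
  have measureReal_far_le (j : ℕ) (hj : j ≤ 2 * k + 1) :
      (labelMeasure V).real (far j) ≤ (d + 1) ^ (4 * k + 4) / ε ^ 2 / Fintype.card V := by
    have hGj : (cyclicCount G (j + 1) : ℝ) ≤ ε * Fintype.card V :=
      (Nat.cast_le.2 (cyclicCount_mono G (by lia))).trans hG
    refine (measureReal_le_abs_occupiedCount_sub_treeOccupation_le hd hε hGj).trans ?_
    gcongr
    · exact le_add_of_nonneg_left d.cast_nonneg
    · lia
  have compl_le := measureReal_le_uniformProb_vertexOrder
    (A := (far (2 * k) ∪ far (2 * k + 1))ᶜ) (p := fun π => |greedyRatio G π - c| < 3 * ε)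
    fun σ hσ π hπ => by
      simp only [Set.mem_compl_iff, Set.mem_union, not_or, far_def, Set.mem_ofPred_eq,
        not_le] at hσ
      exact abs_greedyRatio_sub_lt hπ k hσ.1 hσ.2 hodd heven
  have one_le : 1 ≤ (labelMeasure V).real (far (2 * k) ∪ far (2 * k + 1)) +
      (labelMeasure V).real (far (2 * k) ∪ far (2 * k + 1))ᶜ := by
    rw [← probReal_univ (μ := labelMeasure V), ← Set.union_compl_self]
    exact measureReal_union_le _ _
  have union_le := measureReal_union_le (μ := labelMeasure V) (far (2 * k)) (far (2 * k + 1))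
  rw [mul_div_assoc]
  linarith [measureReal_far_le (2 * k) (by lia), measureReal_far_le (2 * k + 1) le_rfl]

theorem exists_one_sub_le_uniformProb_abs_greedyRatio_sub_lt (hd : 3 ≤ d) (hε : 0 < ε) :
    ∃ (r : ℕ) (δ C : ℝ), 0 < δ ∧ ∀ (V : Type*) [Fintype V] [Nonempty V] (G : SimpleGraph V)
      [G.LocallyFinite], G.IsRegularOfDegree d → cyclicCount G r ≤ δ * Fintype.card V →
        1 - C / Fintype.card V ≤
          uniformProb (VertexOrder V) (fun π => |greedyRatio G π - greedyLimit d| < ε) := by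
  obtain ⟨k, hk⟩ := Metric.tendsto_atTop.1 (tendsto_treeOccupation hd) (ε / 3) (by positivity)
  refine ⟨2 * k + 2, ε / 3, 2 * ((d + 1) ^ (4 * k + 4) / (ε / 3) ^ 2), by positivity, ?_⟩
  intro V _ _ G _ hG hcyclic
  have close := one_sub_le_uniformProb_abs_greedyRatio_sub_lt hG (by positivity) hcyclic
    (hk (2 * k) (by lia)) (hk (2 * k + 1) (by lia))
  rwa [mul_div_cancel₀ ε three_ne_zero] at close

end CyclicCount

/-! ### Switchings of regular graphs -/

section Switching

variable {V : Type*} {G G' : SimpleGraph V} {x y u v : V}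

/-- The graph obtained from `G` by replacing the edges `xy` and `uv` by `xu` and `yv`. -/
def switching (G : SimpleGraph V) (x y u v : V) : SimpleGraph V :=
  SimpleGraph.fromEdgeSet ((G.edgeSet \ {s(x, y), s(u, v)}) ∪ {s(x, u), s(y, v)})

/-- The conditions under which replacing the edges `xy` and `uv` by `xu` and `yv` yields a simple
graph with the same degrees. -/
structure Switchable (G : SimpleGraph V) (x y u v : V) : Prop where
  adj_left : G.Adj x y
  adj_right : G.Adj u v
  ne_fst : x ≠ u
  not_adj_fst : ¬ G.Adj x u
  ne_snd : y ≠ v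
  not_adj_snd : ¬ G.Adj y v

namespace Switchable

lemma edgeSet_switching (h : Switchable G x y u v) :
    (switching G x y u v).edgeSet = (G.edgeSet \ {s(x, y), s(u, v)}) ∪ {s(x, u), s(y, v)} := by
  rw [switching, SimpleGraph.edgeSet_fromEdgeSet, sdiff_eq_left, Set.disjoint_left]
  rintro e (⟨he, -⟩ | rfl | rfl) hdiag
  · exact G.not_isDiag_of_mem_edgeSet he hdiag
  · exact h.ne_fst (by simpa using hdiag)
  · exact h.ne_snd (by simpa using hdiag)

lemma edgeSet_eq (h : Switchable G x y u v) :
    G.edgeSet = ((switching G x y u v).edgeSet \ {s(x, u), s(y, v)}) ∪ {s(x, y), s(u, v)} := by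
  have hxy : s(x, y) ∈ G.edgeSet := h.adj_left
  have huv : s(u, v) ∈ G.edgeSet := h.adj_right
  have hxu : s(x, u) ∉ G.edgeSet := h.not_adj_fst
  have hyv : s(y, v) ∉ G.edgeSet := h.not_adj_snd
  rw [h.edgeSet_switching]
  ext e
  simp only [Set.mem_union, Set.mem_sdiff, Set.mem_insert_iff, Set.mem_singleton_iff]
  grind

lemma eq_of_switching_eq (h : Switchable G x y u v) (h' : Switchable G' x y u v)
    (heq : switching G x y u v = switching G' x y u v) : G = G' :=
  SimpleGraph.edgeSet_inj.1 (by rw [h.edgeSet_eq, heq, ← h'.edgeSet_eq])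

open Classical in
lemma adj_switching_iff (h : Switchable G x y u v) (a b : V) :
    (switching G x y u v).Adj a b ↔
      G.Adj a ((if a = x ∨ a = v then Equiv.swap y u
        else if a = y ∨ a = u then Equiv.swap x v else 1) b) := by
  have := h.adj_left.ne
  have := h.adj_right.ne
  have hsymm (a b : V) : G.Adj a b → G.Adj b a := SimpleGraph.Adj.symm
  rw [← SimpleGraph.mem_edgeSet, h.edgeSet_switching]
  obtain ⟨hxy, huv, hxu, hnxu, hyv, hnyv⟩ := h
  simp only [Set.mem_union, Set.mem_sdiff, SimpleGraph.mem_edgeSet, Set.mem_insert_iff,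
    Set.mem_singleton_iff, Sym2.eq_iff]
  split_ifs <;> simp only [Equiv.swap_apply_def, Equiv.Perm.one_apply] <;> grind

lemma degree_switching (h : Switchable G x y u v) (a : V)
    [Fintype ((switching G x y u v).neighborSet a)] [Fintype (G.neighborSet a)] :
    (switching G x y u v).degree a = G.degree a := by
  classical
  rw [← SimpleGraph.card_neighborSet_eq_degree, ← SimpleGraph.card_neighborSet_eq_degree]
  exact Fintype.card_congr (Equiv.subtypeEquiv _ (h.adj_switching_iff a))

end Switchable

end Switching

section RegularContaining

open Classical
open scoped Finset

variable {V : Type*} [Fintype V] {G : SimpleGraph V} {d : ℕ} {x y u v : V}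

/-- The `d`-regular graphs on `V` which contain all edges in `F`. -/
noncomputable def regularContaining (V : Type*) [Fintype V] (d : ℕ) (F : Finset (Sym2 V)) :
    Finset (SimpleGraph V) :=
  {G | G.IsRegularOfDegree d ∧ ↑F ⊆ G.edgeSet}

variable {F : Finset (Sym2 V)}

lemma mem_regularContaining :
    G ∈ regularContaining V d F ↔ G.IsRegularOfDegree d ∧ ↑F ⊆ G.edgeSet := by
  simp [regularContaining]

lemma card_filter_mk_mem_le (F : Finset (Sym2 V)) :
    #{q : V × V | s(q.1, q.2) ∈ F} ≤ 2 * #F := by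
  refine Finset.card_le_mul_card_image_of_maps_to (f := fun q => s(q.1, q.2)) (by simp) 2 ?_
  rintro ⟨a, b⟩ -
  refine (Finset.card_le_card (t := {(a, b), (b, a)}) fun q hq => ?_).trans Finset.card_le_two
  simpa [Prod.ext_iff] using (Finset.mem_filter.1 hq).2

lemma card_filter_fst_mem_adj (hG : G.IsRegularOfDegree d) (s : Finset V) :
    #{q : V × V | q.1 ∈ s ∧ G.Adj q.1 q.2} = #s * d := by
  calc #{q : V × V | q.1 ∈ s ∧ G.Adj q.1 q.2}
      = #{q ∈ s ×ˢ (Finset.univ : Finset V) | G.Adj q.1 q.2} := by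
        congr 1
        ext
        simp
    _ = ∑ a ∈ s, #{b | G.Adj a b} := by simp only [Finset.card_filter, Finset.sum_product]
    _ = #s * d := Finset.sum_const_nat fun a _ => by
        rw [← hG a, ← G.card_neighborFinset_eq_degree, G.neighborFinset_eq_filter]

lemma card_filter_snd_mem_adj (hG : G.IsRegularOfDegree d) (s : Finset V) :
    #{q : V × V | q.2 ∈ s ∧ G.Adj q.1 q.2} = #s * d := by
  rw [← card_filter_fst_mem_adj hG s]
  exact Finset.card_equiv (Equiv.prodComm V V) (by simp [G.adj_comm])

lemma mul_card_le_card_switchable_add (hG : G.IsRegularOfDegree d) (hxy : G.Adj x y)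
    (F : Finset (Sym2 V)) :
    d * Fintype.card V ≤ #{q : V × V | Switchable G x y q.1 q.2 ∧ s(q.1, q.2) ∉ F} +
      (2 * d * (d + 1) + 2 * #F) := by
  set N : V → Finset V := fun a => insert a (G.neighborFinset a) with N_def
  have card_N_le (a : V) : #(N a) ≤ d + 1 :=
    (Finset.card_insert_le _ _).trans_eq (by rw [G.card_neighborFinset_eq_degree, hG a])
  set S : Finset (V × V) := {q | Switchable G x y q.1 q.2 ∧ s(q.1, q.2) ∉ F} with S_def
  set nearFst : Finset (V × V) := {q | q.1 ∈ N x ∧ G.Adj q.1 q.2} with nearFst_def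
  set nearSnd : Finset (V × V) := {q | q.2 ∈ N y ∧ G.Adj q.1 q.2} with nearSnd_def
  set forbidden : Finset (V × V) := {q | s(q.1, q.2) ∈ F} with forbidden_def
  set edges : Finset (V × V) := {q | q.1 ∈ Finset.univ ∧ G.Adj q.1 q.2} with edges_def
  have edges_subset : edges ⊆ S ∪ (nearFst ∪ nearSnd ∪ forbidden) := by
    rintro ⟨u, v⟩ huv
    simp only [edges_def, S_def, nearFst_def, nearSnd_def, forbidden_def, N_def, Finset.mem_union,
      Finset.mem_filter, Finset.mem_univ, true_and, Finset.mem_insert,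
      SimpleGraph.mem_neighborFinset] at huv ⊢
    by_contra! hbad
    have switchable : Switchable G x y u v := ⟨hxy, huv, by grind, by grind, by grind, by grind⟩
    grind
  calc d * Fintype.card V = #edges := by
        rw [edges_def, card_filter_fst_mem_adj hG, Finset.card_univ, mul_comm]
    _ ≤ #S + (#nearFst + #nearSnd + #forbidden) := by
        grw [edges_subset, Finset.card_union_le, Finset.card_union_le, Finset.card_union_le]
    _ = #S + (#(N x) * d + #(N y) * d + #forbidden) := by
        rw [nearFst_def, nearSnd_def, card_filter_fst_mem_adj hG, card_filter_snd_mem_adj hG]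
    _ ≤ #S + ((d + 1) * d + (d + 1) * d + 2 * #F) := by
        grw [card_N_le, card_N_le, forbidden_def, card_filter_mk_mem_le]
    _ = #S + (2 * d * (d + 1) + 2 * #F) := by ring

lemma Switchable.switching_mem_regularContaining (h : Switchable G x y u v)
    (hG : G ∈ regularContaining V d F) (hxy : s(x, y) ∉ F) (huv : s(u, v) ∉ F) :
    switching G x y u v ∈ regularContaining V d F := by
  rw [mem_regularContaining] at hG ⊢
  refine ⟨fun a => (h.degree_switching a).trans (hG.1 a), fun e he => ?_⟩
  rw [h.edgeSet_switching]
  refine Or.inl ⟨hG.2 he, ?_⟩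
  rintro (rfl | rfl)
  exacts [hxy he, huv he]

-- A graph is determined by its switching together with the pair `(u, v)` used, and in the switching
-- `u` and `v` are neighbours of `x` and `y`, which leaves `d * d` possible pairs.
lemma sum_card_switchable_le (hF : s(x, y) ∉ F) :
    ∑ G ∈ regularContaining V d (insert s(x, y) F),
        #{q : V × V | Switchable G x y q.1 q.2 ∧ s(q.1, q.2) ∉ F} ≤
      #(regularContaining V d F) * (d * d) := by
  have card_pairs (G) (hG : G ∈ regularContaining V d F) :
      #(G.neighborFinset x ×ˢ G.neighborFinset y) = d * d := by
    rw [Finset.card_product, G.card_neighborFinset_eq_degree, G.card_neighborFinset_eq_degree,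
      (mem_regularContaining.1 hG).1 x, (mem_regularContaining.1 hG).1 y]
  rw [← Finset.sum_const_nat card_pairs, ← Finset.card_sigma, ← Finset.card_sigma]
  refine Finset.card_le_card_of_injOn (fun p => ⟨switching p.1 x y p.2.1 p.2.2, p.2⟩) ?_ ?_
  · rintro ⟨G, u, v⟩ hp
    simp only [Finset.coe_sigma, Set.mem_sigma_iff, Finset.mem_coe, Finset.mem_filter,
      Finset.mem_univ, true_and, Finset.mem_product, SimpleGraph.mem_neighborFinset,
      ← SimpleGraph.mem_edgeSet] at hp ⊢
    obtain ⟨hG, hswitch, huv⟩ := hp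
    have hG' : G ∈ regularContaining V d F := by
      rw [mem_regularContaining, Finset.coe_insert] at hG
      exact mem_regularContaining.2 ⟨hG.1, (Set.subset_insert _ _).trans hG.2⟩
    refine ⟨hswitch.switching_mem_regularContaining hG' hF huv, ?_⟩
    simp [hswitch.edgeSet_switching]
  · rintro ⟨G, q⟩ hp ⟨G', q'⟩ hp' heq
    obtain ⟨heq, rfl⟩ : switching G x y q.1 q.2 = switching G' x y q'.1 q'.2 ∧ q = q' := by
      simpa using heq
    have hswitch : Switchable G x y q.1 q.2 := (Finset.mem_filter.1 (Finset.mem_sigma.1 hp).2).2.1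
    have hswitch' : Switchable G' x y q.1 q.2 :=
      (Finset.mem_filter.1 (Finset.mem_sigma.1 hp').2).2.1
    rw [hswitch.eq_of_switching_eq hswitch' heq]

lemma card_regularContaining_insert_mul_le (hd : 0 < d)
    (hn : 4 * (d + 1 + #F) ≤ Fintype.card V) (hF : s(x, y) ∉ F) :
    #(regularContaining V d (insert s(x, y) F)) * Fintype.card V ≤
      2 * d * #(regularContaining V d F) := by
  set R := regularContaining V d (insert s(x, y) F)
  have switchings_ge : #R * (d * Fintype.card V) ≤
      #(regularContaining V d F) * (d * d) + #R * (2 * d * (d + 1) + 2 * #F) := by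
    calc #R * (d * Fintype.card V) = ∑ _G ∈ R, d * Fintype.card V := by
          rw [Finset.sum_const, smul_eq_mul]
      _ ≤ ∑ G ∈ R, (#{q : V × V | Switchable G x y q.1 q.2 ∧ s(q.1, q.2) ∉ F} +
            (2 * d * (d + 1) + 2 * #F)) := Finset.sum_le_sum fun G hG =>
          have hG := mem_regularContaining.1 hG
          mul_card_le_card_switchable_add hG.1 (hG.2 (Finset.mem_insert_self _ F)) F
      _ ≤ #(regularContaining V d F) * (d * d) + #R * (2 * d * (d + 1) + 2 * #F) := by
          rw [Finset.sum_add_distrib, Finset.sum_const, smul_eq_mul]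
          grw [sum_card_switchable_le hF]
  have excluded_le : 2 * (2 * d * (d + 1) + 2 * #F) ≤ d * Fintype.card V :=
    calc 2 * (2 * d * (d + 1) + 2 * #F) ≤ d * (4 * (d + 1 + #F)) := by nlinarith
      _ ≤ d * Fintype.card V := by gcongr
  have := Nat.mul_le_mul_left #R excluded_le
  refine Nat.le_of_mul_le_mul_left (c := d) ?_ hd
  linarith

lemma card_regularContaining_mul_le (hd : 0 < d) (F : Finset (Sym2 V))
    (hn : 4 * (d + #F) ≤ Fintype.card V) :
    #(regularContaining V d F) * Fintype.card V ^ #F ≤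
      (2 * d) ^ #F * #(regularContaining V d ∅) := by
  induction F using Finset.induction_on with
  | empty => simp
  | insert e F he ih =>
    rw [Finset.card_insert_of_notMem he] at hn ⊢
    cases e with | _ x y =>
    have insert_le := card_regularContaining_insert_mul_le hd (by lia) he
    calc #(regularContaining V d (insert s(x, y) F)) * Fintype.card V ^ (#F + 1)
        = #(regularContaining V d (insert s(x, y) F)) * Fintype.card V * Fintype.card V ^ #F := by
          ring
      _ ≤ 2 * d * #(regularContaining V d F) * Fintype.card V ^ #F := by gcongr
      _ = 2 * d * (#(regularContaining V d F) * Fintype.card V ^ #F) := by ring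
      _ ≤ 2 * d * ((2 * d) ^ #F * #(regularContaining V d ∅)) := Nat.mul_le_mul_left _ (ih (by lia))
      _ = (2 * d) ^ (#F + 1) * #(regularContaining V d ∅) := by ring

end RegularContaining

/-! ### Short cycles -/

section ShortCycles

variable {V : Type*} {G : SimpleGraph V} {a b v z : V} {d l r : ℕ}

lemma edist_le_of_mem_support_tail (p : (ballGraph G v r).Walk a b) (hz : z ∈ p.support.tail) :
    G.edist v z ≤ r := by
  induction p with
  | nil => simp at hz
  | cons hadj p ih =>
    rw [SimpleGraph.Walk.support_cons, List.tail_cons, SimpleGraph.Walk.mem_support_iff] at hz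
    obtain rfl | hz := hz
    exacts [hadj.2.2, ih hz]

lemma exists_isCycle_of_not_isAcyclic_ballGraph [G.LocallyFinite] (hd : ∀ v, G.degree v ≤ d)
    (h : ¬ (ballGraph G v r).IsAcyclic) :
    ∃ (a : V) (p : G.Walk a a), p.IsCycle ∧ p.length ≤ (d + 1) ^ r ∧ G.edist v a ≤ r := by
  classical
  simp only [SimpleGraph.IsAcyclic, not_forall, not_not] at h
  obtain ⟨a, p, hp⟩ := h
  have ballGraph_le : ballGraph G v r ≤ G := fun _ _ hab => hab.1
  refine ⟨a, p.mapLe ballGraph_le, (SimpleGraph.Walk.isCycle_mapLe _).2 hp, ?_,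
    edist_le_of_mem_support_tail p (SimpleGraph.Walk.end_mem_tail_support hp.not_nil)⟩
  calc (p.mapLe ballGraph_le).length = p.support.tail.length := by simp
    _ = {z | z ∈ p.support.tail}.ncard := by
        rw [← List.toFinset_card_of_nodup hp.support_nodup, ← Set.ncard_coe_finset,
          List.coe_toFinset]
    _ ≤ {z | G.edist v z ≤ r}.ncard :=
        Set.ncard_le_ncard (fun z hz => edist_le_of_mem_support_tail p hz) (finite_closedBall v r)
    _ ≤ (d + 1) ^ r := ncard_closedBall_le hd v r

lemma cyclicCount_eq_zero_of_lt_girth [G.LocallyFinite] (hd : ∀ v, G.degree v ≤ d)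
    (h : (d + 1) ^ r < G.girth) : cyclicCount G r = 0 := by
  have all_acyclic : {v | ¬ (ballGraph G v r).IsAcyclic} = ∅ := by
    refine Set.eq_empty_of_forall_notMem fun v hv => ?_
    obtain ⟨a, p, hp, hlength, -⟩ := exists_isCycle_of_not_isAcyclic_ballGraph hd hv
    exact (hlength.trans_lt h).not_ge (SimpleGraph.girth_le_length hp)
  rw [cyclicCount, all_acyclic, Set.ncard_empty]

lemma girth_le_card [Fintype V] (G : SimpleGraph V) : G.girth ≤ Fintype.card V := by
  by_cases h : G.IsAcyclic
  · simp [SimpleGraph.girth_eq_zero.2 h]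
  · obtain ⟨a, p, hp, hlength⟩ := SimpleGraph.exists_girth_eq_length.2 h
    simpa [hlength] using hp.support_nodup.length_le_card

open Classical
open scoped Finset

/-- The edges of the closed walk which visits the vertices `f 0, …, f l` in cyclic order. -/
noncomputable def closedWalkEdges (f : Fin (l + 1) → V) : Finset (Sym2 V) :=
  Finset.univ.image fun i => s(f i, f (i + 1))

lemma closedWalkEdges_getVert (p : G.Walk a a) (hp : p.length = l + 1) :
    closedWalkEdges (fun i : Fin (l + 1) => p.getVert i) = p.edges.toFinset := by
  have getVert_succ (i : Fin (l + 1)) :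
      p.getVert (i + 1 : Fin (l + 1)) = p.getVert (i + 1 : ℕ) := by
    obtain hi | hi := i.le_last.eq_or_lt
    · rw [hi, Fin.last_add_one, Fin.val_zero, Fin.val_last, ← hp, p.getVert_zero, p.getVert_length]
    · rw [Fin.val_add_one_of_lt hi]
  ext e
  cases e with | _ u v =>
  simp only [closedWalkEdges, getVert_succ, Finset.mem_image, Finset.mem_univ, true_and,
    List.mem_toFinset, p.mk_mem_edges_iff_exists, Fin.exists_iff, hp, exists_prop]

variable [Fintype V]

/-- The closed trails of length `l + 1` in `G`, encoded by the vertices they visit. -/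
noncomputable def closedTrails (G : SimpleGraph V) (l : ℕ) : Finset (Fin (l + 1) → V) :=
  {f | #(closedWalkEdges f) = l + 1 ∧ ↑(closedWalkEdges f) ⊆ G.edgeSet}

lemma exists_mem_closedTrails_of_isCycle {p : G.Walk a a} (hp : p.IsCycle) :
    ∃ l < p.length, ∃ f ∈ closedTrails G l, f 0 = a := by
  obtain ⟨l, hl⟩ : ∃ l, p.length = l + 1 :=
    Nat.exists_eq_add_one.2 (three_pos.trans_le hp.three_le_length)
  refine ⟨l, by lia, fun i => p.getVert i, ?_, p.getVert_zero⟩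
  rw [closedTrails, Finset.mem_filter_univ, closedWalkEdges_getVert p hl,
    List.toFinset_card_of_nodup hp.edges_nodup, p.length_edges, List.coe_toFinset]
  exact ⟨hl, fun e he => p.edges_subset_edgeSet he⟩

lemma cyclicCount_le_sum_card_closedTrails (hd : ∀ v, G.degree v ≤ d) (r : ℕ) :
    cyclicCount G r ≤ ∑ l ∈ Finset.range ((d + 1) ^ r), #(closedTrails G l) * (d + 1) ^ r := by
  have subset_biUnion : {v | ¬ (ballGraph G v r).IsAcyclic} ⊆
      ⋃ l ∈ Finset.range ((d + 1) ^ r), ⋃ f ∈ closedTrails G l, {v | G.edist (f 0) v ≤ r} := by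
    intro v hv
    obtain ⟨a, p, hp, hlength, hva⟩ := exists_isCycle_of_not_isAcyclic_ballGraph hd hv
    obtain ⟨l, hl, f, hf, rfl⟩ := exists_mem_closedTrails_of_isCycle hp
    simp only [Set.mem_iUnion]
    exact ⟨l, Finset.mem_range.2 (hl.trans_le hlength), f, hf, SimpleGraph.edist_comm.trans_le hva⟩
  refine (Set.ncard_le_ncard subset_biUnion).trans <|
    (Finset.set_ncard_biUnion_le _ _).trans <| Finset.sum_le_sum fun l _ =>
    (Finset.set_ncard_biUnion_le _ _).trans <| Finset.sum_le_card_nsmul _ _ _ fun f _ =>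
    ncard_closedBall_le hd (f 0) r

lemma sum_card_closedTrails_le (hd : 0 < d) (hl : 4 * (d + (l + 1)) ≤ Fintype.card V) :
    ∑ G ∈ regularContaining V d ∅, #(closedTrails G l) ≤
      (2 * d) ^ (l + 1) * #(regularContaining V d ∅) := by
  set trails : Finset (Fin (l + 1) → V) := {f | #(closedWalkEdges f) = l + 1} with trails_def
  have double_count : ∑ G ∈ regularContaining V d ∅, #(closedTrails G l) =
      ∑ f ∈ trails, #(regularContaining V d (closedWalkEdges f)) := by
    convert Finset.sum_card_bipartiteAbove_eq_sum_card_bipartiteBelow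
      (s := regularContaining V d ∅) (t := trails) (fun G f => ↑(closedWalkEdges f) ⊆ G.edgeSet)
      using 3 with G _ f _
    · simp [closedTrails, Finset.bipartiteAbove, trails, Finset.filter_filter]
    · ext G
      simp [mem_regularContaining, Finset.bipartiteBelow]
  have hpos : 0 < Fintype.card V ^ (l + 1) := Nat.pow_pos (by lia)
  refine Nat.le_of_mul_le_mul_right ?_ hpos
  calc (∑ G ∈ regularContaining V d ∅, #(closedTrails G l)) * Fintype.card V ^ (l + 1)
      = ∑ f ∈ trails, #(regularContaining V d (closedWalkEdges f)) * Fintype.card V ^ (l + 1) := by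
        rw [double_count, Finset.sum_mul]
    _ ≤ ∑ f ∈ trails, (2 * d) ^ (l + 1) * #(regularContaining V d ∅) := by
        refine Finset.sum_le_sum fun f hf => ?_
        have hf : #(closedWalkEdges f) = l + 1 := (Finset.mem_filter.1 hf).2
        simpa only [hf] using
          card_regularContaining_mul_le hd (closedWalkEdges f) (by rwa [hf])
    _ ≤ Fintype.card V ^ (l + 1) * ((2 * d) ^ (l + 1) * #(regularContaining V d ∅)) := by
        rw [Finset.sum_const, smul_eq_mul]
        gcongr
        simpa using Finset.card_le_univ trails
    _ = (2 * d) ^ (l + 1) * #(regularContaining V d ∅) * Fintype.card V ^ (l + 1) := by ring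

/-- An upper bound for the average of `cyclicCount G r` over the `d`-regular graphs on a given large
vertex set. -/
def cyclicCountBound (d r : ℕ) : ℕ :=
  (∑ l ∈ Finset.range ((d + 1) ^ r), (2 * d) ^ (l + 1)) * (d + 1) ^ r

lemma sum_cyclicCount_le (hd : 0 < d) (hn : 4 * (d + (d + 1) ^ r) ≤ Fintype.card V) :
    ∑ G ∈ regularContaining V d ∅, cyclicCount G r ≤
      cyclicCountBound d r * #(regularContaining V d ∅) := by
  calc ∑ G ∈ regularContaining V d ∅, cyclicCount G r
      ≤ ∑ G ∈ regularContaining V d ∅,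
          ∑ l ∈ Finset.range ((d + 1) ^ r), #(closedTrails G l) * (d + 1) ^ r :=
        Finset.sum_le_sum fun G hG => cyclicCount_le_sum_card_closedTrails
          (fun v => ((mem_regularContaining.1 hG).1 v).le) r
    _ = ∑ l ∈ Finset.range ((d + 1) ^ r),
          (∑ G ∈ regularContaining V d ∅, #(closedTrails G l)) * (d + 1) ^ r := by
        simp only [Finset.sum_comm (s := regularContaining V d ∅), ← Finset.sum_mul]
    _ ≤ ∑ l ∈ Finset.range ((d + 1) ^ r),
          (2 * d) ^ (l + 1) * #(regularContaining V d ∅) * (d + 1) ^ r := by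
        refine Finset.sum_le_sum fun l hl => Nat.mul_le_mul_right _ (sum_card_closedTrails_le hd ?_)
        have := Finset.mem_range.1 hl
        lia
    _ = cyclicCountBound d r * #(regularContaining V d ∅) := by
        rw [cyclicCountBound, ← Finset.sum_mul, ← Finset.sum_mul, mul_right_comm]

end ShortCycles

/-! ### Existence of regular graphs -/

section ExistenceOfRegularGraphs

open scoped Finset

lemma isRegularOfDegree_circulantGraph {A : Type*} [AddGroup A] {S : Finset A}
    [(SimpleGraph.circulantGraph (S : Set A)).LocallyFinite]
    (zero_notMem : 0 ∉ S) (neg_mem : ∀ s ∈ S, -s ∈ S) :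
    (SimpleGraph.circulantGraph (S : Set A)).IsRegularOfDegree #S := by
  intro a
  rw [← SimpleGraph.card_neighborFinset_eq_degree, ← S.card_map (addRightEmbedding a)]
  congr 1
  ext b
  have sub_mem_iff : a - b ∈ S ↔ b - a ∈ S :=
    ⟨fun h => by simpa using neg_mem _ h, fun h => by simpa using neg_mem _ h⟩
  have ne_of_sub_mem (h : b - a ∈ S) : a ≠ b := by
    rintro rfl
    exact zero_notMem (by simpa using h)
  simp only [SimpleGraph.mem_neighborFinset, SimpleGraph.circulantGraph_adj, Finset.mem_coe,
    sub_mem_iff, or_self, Finset.mem_map, addRightEmbedding_apply, ← eq_sub_iff_add_eq,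
    exists_eq_right]
  exact and_iff_right_of_imp ne_of_sub_mem

open Classical in
lemma exists_isRegularOfDegree_two_mul {n j : ℕ} (h : 2 * j < n) :
    ∃ G : SimpleGraph (Fin n), G.IsRegularOfDegree (2 * j) := by
  have : NeZero n := ⟨by lia⟩
  set S : Finset (Fin n) := {i | 1 ≤ i.val ∧ i.val ≤ j ∨ n - j ≤ i.val} with S_def
  have card_S : #S = 2 * j := by
    have map_S : S.map Fin.valEmbedding = Finset.Icc 1 j ∪ Finset.Ico (n - j) n := by
      ext i
      simp only [S_def, Finset.mem_map, Finset.mem_filter_univ, Fin.valEmbedding_apply,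
        Finset.mem_union, Finset.mem_Icc, Finset.mem_Ico]
      exact ⟨by rintro ⟨a, ha, rfl⟩; lia, fun hi => ⟨⟨i, by lia⟩, by lia, rfl⟩⟩
    have disjoint_intervals : Disjoint (Finset.Icc 1 j) (Finset.Ico (n - j) n) := by
      simp only [Finset.disjoint_left, Finset.mem_Icc, Finset.mem_Ico]
      lia
    rw [← Finset.card_map Fin.valEmbedding, map_S, Finset.card_union_of_disjoint disjoint_intervals,
      Nat.card_Icc, Nat.card_Ico]
    lia
  have zero_notMem : 0 ∉ S := by
    rw [S_def, Finset.mem_filter_univ, Fin.val_zero]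
    lia
  have neg_mem (s : Fin n) (hs : s ∈ S) : -s ∈ S := by
    rw [S_def, Finset.mem_filter_univ] at hs ⊢
    rw [Fin.val_neg', Nat.mod_eq_of_lt (by lia)]
    lia
  refine ⟨SimpleGraph.circulantGraph (S : Set (Fin n)), ?_⟩
  convert isRegularOfDegree_circulantGraph zero_notMem neg_mem
  exact card_S.symm

lemma nonempty_regularGraphOn {n d : ℕ} (hdn : d < n) (heven : Even (d * n)) :
    Nonempty (RegularGraphOn n d) := by
  obtain ⟨j, hj⟩ | hodd := d.even_or_odd
  · obtain ⟨G, hG⟩ := exists_isRegularOfDegree_two_mul (n := n) (j := j) (by lia)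
    exact ⟨G, by rwa [hj, ← two_mul]⟩
  · obtain ⟨j, hj⟩ : Even (n - 1 - d) := by
      have := (Nat.even_mul.1 heven).resolve_left (Nat.not_even_iff_odd.2 hodd)
      grind
    obtain ⟨G, hG⟩ := exists_isRegularOfDegree_two_mul (n := n) (j := j) (by lia)
    have degree_compl : Fintype.card (Fin n) - 1 - 2 * j = d := by
      rw [Fintype.card_fin]
      lia
    refine ⟨Gᶜ, ?_⟩
    convert hG.compl
    exact degree_compl.symm

end ExistenceOfRegularGraphs

/-! ### Convergence in probability -/

section UniformProb

variable {A B Ω : Type*}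

lemma uniformProb_le_one [Finite Ω] (p : Ω → Prop) : uniformProb Ω p ≤ 1 :=
  div_le_one_of_le₀ (by exact_mod_cast Finite.card_subtype_le p) (Nat.cast_nonneg _)

lemma card_mul_uniformProb [Finite Ω] [Nonempty Ω] (p : Ω → Prop) :
    Nat.card Ω * uniformProb Ω p = Nat.card {ω // p ω} :=
  mul_div_cancel₀ _ (Nat.cast_ne_zero.2 Nat.card_pos.ne')

lemma one_sub_div_le_uniformProb_le [Fintype Ω] [Nonempty Ω] {f : Ω → ℝ} {K t : ℝ}
    (f_nonneg : ∀ ω, 0 ≤ f ω) (ht : 0 < t) (sum_le : ∑ ω, f ω ≤ K * Fintype.card Ω) :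
    1 - K / t ≤ uniformProb Ω (fun ω => f ω ≤ t) := by
  classical
  have card_bad_mul_le : (Fintype.card {ω // ¬ f ω ≤ t} : ℝ) * t ≤ K * Fintype.card Ω := calc
    _ = ∑ ω with ¬ f ω ≤ t, t := by
      rw [Finset.sum_const, nsmul_eq_mul, Fintype.card_subtype]
    _ ≤ ∑ ω with ¬ f ω ≤ t, f ω :=
      Finset.sum_le_sum fun ω hω => (not_le.1 (Finset.mem_filter.1 hω).2).le
    _ ≤ ∑ ω, f ω := Finset.sum_le_univ_sum_of_nonneg f_nonneg
    _ ≤ K * Fintype.card Ω := sum_le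
  have card_pos : 0 < (Fintype.card Ω : ℝ) := Nat.cast_pos.2 Fintype.card_pos
  rw [Fintype.card_subtype_compl, Nat.cast_sub (Fintype.card_subtype_le _)] at card_bad_mul_le
  rw [uniformProb, Nat.card_eq_fintype_card, Nat.card_eq_fintype_card, le_div_iff₀ card_pos,
    sub_mul, one_mul, div_mul_eq_mul_div, sub_le_comm, le_div_iff₀ ht]
  exact card_bad_mul_le

lemma mul_uniformProb_le_uniformProb_prod [Finite A] [Finite B] [Nonempty A] [Nonempty B]
    {good : A → Prop} {p : A × B → Prop} {q : ℝ}
    (h : ∀ a, good a → q ≤ uniformProb B (fun b => p (a, b))) :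
    q * uniformProb A good ≤ uniformProb (A × B) p := by
  classical
  have := Fintype.ofFinite A
  have card_B_pos : 0 < (Nat.card B : ℝ) := Nat.cast_pos.2 Nat.card_pos
  have card_le : (Nat.card A * uniformProb A good) * (q * Nat.card B) ≤
      Nat.card {ω : A × B // p ω} := calc
    _ = ∑ a with good a, q * Nat.card B := by
      rw [card_mul_uniformProb, Finset.sum_const, nsmul_eq_mul, Nat.card_eq_fintype_card,
        Fintype.card_subtype]
    _ ≤ ∑ a with good a, (Nat.card {b // p (a, b)} : ℝ) :=
      Finset.sum_le_sum fun a ha => (le_div_iff₀ card_B_pos).1 (h a (Finset.mem_filter.1 ha).2)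
    _ ≤ ∑ a, (Nat.card {b // p (a, b)} : ℝ) :=
      Finset.sum_le_univ_sum_of_nonneg fun _ => Nat.cast_nonneg _
    _ = _ := by
      rw [Nat.card_congr (Equiv.subtypeProdEquivSigmaSubtype fun a b => p (a, b)), Nat.card_sigma,
        Nat.cast_sum]
  rw [uniformProb.eq_def (A × B), le_div_iff₀ (Nat.cast_pos.2 Nat.card_pos), Nat.card_prod,
    Nat.cast_mul]
  linarith

end UniformProb

lemma sum_regularGraphOn_cyclicCount_le {n d r : ℕ} [Fintype (RegularGraphOn n d)] (hd : 0 < d)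
    (hn : 4 * (d + (d + 1) ^ r) ≤ n) :
    ∑ G : RegularGraphOn n d, cyclicCount G.1 r ≤
      cyclicCountBound d r * Fintype.card (RegularGraphOn n d) := by
  classical
  have mem_iff (G : SimpleGraph (Fin n)) : G ∈ regularContaining (Fin n) d ∅ ↔
      G.IsRegularOfDegree d := by
    simp [mem_regularContaining]
  rw [← Finset.sum_subtype _ mem_iff fun G => cyclicCount G r, Fintype.card_of_subtype _ mem_iff]
  exact sum_cyclicCount_le hd (by rwa [Fintype.card_fin])

lemma tendsto_one_sub_div_atTop {ι : Type*} {l : Filter ι} {f : ι → ℝ} (hf : Tendsto f l atTop)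
    (C : ℝ) : Tendsto (fun i => 1 - C / f i) l (𝓝 1) := by
  simpa using (hf.const_div_atTop C).const_sub 1

theorem tendsto_uniformProb_of_tendsto_girth {d : ℕ} (hd : 3 ≤ d) {V : ℕ → Type*}
    [∀ n, Fintype (V n)] {G : ∀ n, SimpleGraph (V n)} [∀ n, (G n).LocallyFinite]
    (hreg : ∀ n, (G n).IsRegularOfDegree d) (hgirth : Tendsto (fun n => (G n).girth) atTop atTop)
    {ε : ℝ} (hε : 0 < ε) :
    Tendsto (fun n => uniformProb (VertexOrder (V n))
      (fun π => |greedyRatio (G n) π - greedyLimit d| < ε)) atTop (𝓝 1) := by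
  obtain ⟨r, δ, C, hδ, le_uniformProb⟩ :=
    exists_one_sub_le_uniformProb_abs_greedyRatio_sub_lt hd hε
  have tendsto_card : Tendsto (fun n => (Fintype.card (V n) : ℝ)) atTop atTop :=
    tendsto_natCast_atTop_atTop.comp (tendsto_atTop_mono (fun n => girth_le_card (G n)) hgirth)
  refine tendsto_of_tendsto_of_tendsto_of_le_of_le' (tendsto_one_sub_div_atTop tendsto_card C)
    tendsto_const_nhds ?_ (.of_forall fun n => uniformProb_le_one _)
  filter_upwards [hgirth.eventually_gt_atTop ((d + 1) ^ r)] with n hn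
  have : Nonempty (V n) := Fintype.card_pos_iff.1 (by have := girth_le_card (G n); lia)
  refine le_uniformProb (V n) (G n) (hreg n) ?_
  rw [cyclicCount_eq_zero_of_lt_girth (fun v => (hreg n v).le) hn, Nat.cast_zero]
  positivity

theorem tendsto_uniformProb_regularGraphOn {d : ℕ} (hd : 3 ≤ d) {ε : ℝ} (hε : 0 < ε) :
    Tendsto (fun n : ℕ => uniformProb (RegularGraphOn n d × VertexOrder (Fin n))
      (fun ω => |greedyRatio ω.1.1 ω.2 - greedyLimit d| < ε))
      (atTop ⊓ 𝓟 {n : ℕ | Even (d * n)}) (𝓝 1) := by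
  classical
  obtain ⟨r, δ, C, hδ, le_uniformProb⟩ :=
    exists_one_sub_le_uniformProb_abs_greedyRatio_sub_lt hd hε
  have tendsto_order : Tendsto (fun n : ℕ => 1 - C / (n : ℝ)) atTop (𝓝 1) :=
    tendsto_one_sub_div_atTop tendsto_natCast_atTop_atTop C
  have tendsto_graph : Tendsto (fun n : ℕ => 1 - cyclicCountBound d r / (δ * n)) atTop (𝓝 1) :=
    tendsto_one_sub_div_atTop (tendsto_natCast_atTop_atTop.const_mul_atTop hδ) _
  have tendsto_bound := (tendsto_order.mul tendsto_graph).mono_left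
    (inf_le_left : atTop ⊓ 𝓟 {n : ℕ | Even (d * n)} ≤ atTop)
  rw [mul_one] at tendsto_bound
  refine tendsto_of_tendsto_of_tendsto_of_le_of_le' tendsto_bound
    tendsto_const_nhds ?_ (.of_forall fun n => uniformProb_le_one _)
  rw [eventually_inf_principal]
  filter_upwards [eventually_ge_atTop (4 * (d + (d + 1) ^ r)),
    tendsto_order.eventually (eventually_ge_nhds one_pos)] with n hn order_nonneg heven
  have n_pos : 0 < (n : ℝ) := Nat.cast_pos.2 (by lia)
  have : Nonempty (Fin n) := ⟨0, by lia⟩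
  have : Nonempty (RegularGraphOn n d) := nonempty_regularGraphOn (by lia) heven
  have : Nonempty (VertexOrder (Fin n)) := ⟨(Fintype.equivFin _).symm⟩
  calc _ ≤ (1 - C / (n : ℝ)) * uniformProb (RegularGraphOn n d)
          (fun G => (cyclicCount G.1 r : ℝ) ≤ δ * n) := by
        gcongr
        exact one_sub_div_le_uniformProb_le (fun G => Nat.cast_nonneg _) (by positivity)
          (by exact_mod_cast sum_regularGraphOn_cyclicCount_le (by lia) hn)
    _ ≤ _ := mul_uniformProb_le_uniformProb_prod fun G hG => by
        simpa only [Fintype.card_fin] using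
          le_uniformProb (Fin n) G.1 (by convert G.2) (by rwa [Fintype.card_fin])

theorem mainTheorem8 (d : ℕ) (hd : 3 ≤ d) (c : ℝ)
    (hc : c = 1 / 2 * (1 - ((d : ℝ) - 1) ^ (-2 / ((d : ℝ) - 2)))) :
    -- the `d`-regular tree, with an arbitrary root
    (∀ (V : Type*) (T : SimpleGraph V) [T.LocallyFinite] (ρ : V),
      T.IsTree → T.IsRegularOfDegree d →
        NonexplosiveGrowth T ρ ∧ greedyDensity T ρ = c) ∧
    -- every sequence of finite `d`-regular graphs with girth tending to infinity
    (∀ (V : ℕ → Type*) [∀ n, Fintype (V n)] (G : ∀ n, SimpleGraph (V n))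
      [∀ n, (G n).LocallyFinite],
      (∀ n, (G n).IsRegularOfDegree d) →
      Tendsto (fun n => (G n).girth) atTop atTop →
        ∀ ε : ℝ, 0 < ε →
          Tendsto (fun n => uniformProb (VertexOrder (V n))
            (fun π => |greedyRatio (G n) π - c| < ε)) atTop (𝓝 1)) ∧
    -- the random `d`-regular graph on `n` vertices, as `n` tends to infinity with `d * n` even
    (∀ ε : ℝ, 0 < ε →
      Tendsto (fun n : ℕ => uniformProb (RegularGraphOn n d × VertexOrder (Fin n))
        (fun ω => |greedyRatio ω.1.1 ω.2 - c| < ε))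
        (atTop ⊓ 𝓟 {n : ℕ | Even (d * n)}) (𝓝 1)) := by
  subst hc
  exact ⟨fun V T _ ρ hT hreg => ⟨nonexplosiveGrowth_of_degree_le (fun v => (hreg v).le) ρ,
      greedyDensity_eq_greedyLimit hd hT hreg ρ⟩,
    fun V _ G _ hreg hgirth ε hε => tendsto_uniformProb_of_tendsto_girth hd hreg hgirth hε,
    fun ε hε => tendsto_uniformProb_regularGraphOn hd hε⟩
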